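/- Let $\mathbb O=\mathbb H\oplus\mathbb H$ be the octonions, with multiplication $(q_1,q_2)(p_1,p_2)=(q_1p_1-\bar p_2q_2,\;p_2q_1+q_2\bar p_1)$, conjugation $\overline{(q_1,q_2)}=(\bar q_1,-q_2)$, inner product $\langle a,b\rangle=\mathrm{Re}(a\bar b)$ and norm $|a|^2=\langle a,a\rangle$. The octonionic hyperbolic plane is the open unit ball $\mathbb OH^2=\{(u,v)\in\mathbb O^2 : |u|^2+|v|^2<1\}$ with the metric $$ds^2=\frac{|du|^2(1-|v|^2)+|dv|^2(1-|u|^2)+2\,\mathrm{Re}[(u\bar v)(dv\,d\bar u)]}{(1-|u|^2-|v|^2)^2}.$$ The octonionic projective plane $\mathbb OP^2$ is the quotient of the set of those triples in $\mathbb O^3$ that have at least one entry equal to $1$ by the equivalence relation $[a,b,c]\sim[d,e,f]\iff a=d\lambda,\ b=e\lambda,\ c=f\lambda$ for some $\lambda\in\mathbb O\setminus\{0\}$, with the smooth structure given by the three affine charts $[1,u,v]\mapsto(u,v)$, $[u,1,v]\mapsto(u,v)$, $[u,v,1]\mapsto(u,v)$, and with the metric that in each of these charts is $$ds^2=\frac{|du|^2(1+|v|^2)+|dv|^2(1+|u|^2)-2\,\mathrm{Re}[(u\bar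 v)(dv\,d\bar u)]}{(1+|u|^2+|v|^2)^2}.$$ The Riemann curvature tensor is taken with the sign convention $R_{\alpha\beta\gamma}{}^{\delta}=\partial_\beta\Gamma_{\alpha\gamma}^\delta-\partial_\alpha\Gamma_{\beta\gamma}^\delta+\Gamma_{\beta\epsilon}^\delta\Gamma_{\alpha\gamma}^\epsilon-\Gamma_{\alpha\epsilon}^\delta\Gamma_{\beta\gamma}^\epsilon$ and $R_{\alpha\beta\gamma\delta}=g_{\delta\epsilon}R_{\alpha\beta\gamma}{}^{\epsilon}$, and the tangent spaces of $\mathbb OH^2$ at $P_0=(0,0)$ and of $\mathbb OP^2$ at $[1,0,0]$ are identified with $\mathbb O^2$ by the coordinates $(u,v)$. Theorem. $\mathbb OH^2$ is a $16$-dimensional, simply connected, smooth Riemannian manifold (in particular, the metric above is smooth and positive definite), and it is homogeneous: its isometries act transitively. Its Riemann curvature tensor at $P_0$ is the negative of the Riemann curvature tensor of $\mathbb OP^2$ at $[1,0,0]$, that is, it is $-R$ with $$\begin{aligned}R\big((a,b),(c,d),(e,f),(g,h)\big)={}&4\langle a,e\rangle\langle c,g\rangle-4\langle c,e\rangle\langle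 a,g\rangle+4\langle b,f\rangle\langle d,h\rangle-4\langle d,f\rangle\langle b,h\rangle\\&-\langle e\bar d,g\bar b\rangle+\langle e\bar b,g\bar d\rangle-\langle c\bar f,a\bar h\rangle+\langle a\bar f,c\bar h\rangle-\langle a\bar d-c\bar b,\;g\bar f-e\bar h\rangle.\end{aligned}$$ -/

import Mathlib

open scoped Manifold ContDiff Topology

noncomputable section

/-- The octonions `𝕆 = ℍ ⊕ ℍ`, with the Euclidean norm of `ℝ⁸`. -/
def Octonion : Type := WithLp 2 (Quaternion ℝ × Quaternion ℝ)

namespace Octonion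

instance : NormedAddCommGroup Octonion :=
  inferInstanceAs (NormedAddCommGroup (WithLp 2 (Quaternion ℝ × Quaternion ℝ)))

instance : InnerProductSpace ℝ Octonion :=
  inferInstanceAs (InnerProductSpace ℝ (WithLp 2 (Quaternion ℝ × Quaternion ℝ)))

instance : FiniteDimensional ℝ Octonion :=
  inferInstanceAs (FiniteDimensional ℝ (WithLp 2 (Quaternion ℝ × Quaternion ℝ)))

/-- The octonion `(q₁, q₂)`. -/
def mk (q₁ q₂ : Quaternion ℝ) : Octonion := WithLp.toLp 2 (q₁, q₂)

/-- The first quaternion component. -/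
def fst (a : Octonion) : Quaternion ℝ := WithLp.fst a

/-- The second quaternion component. -/
def snd (a : Octonion) : Quaternion ℝ := WithLp.snd a

/-- The real part. -/
def re (a : Octonion) : ℝ := a.fst.re

/-- Cayley–Dickson multiplication
`(q₁, q₂) * (p₁, p₂) = (q₁ p₁ - p̄₂ q₂, p₂ q₁ + q₂ p̄₁)`. -/
instance : Mul Octonion :=
  ⟨fun a b => mk (a.fst * b.fst - star b.snd * a.snd) (b.snd * a.fst + a.snd * star b.fst)⟩

instance : One Octonion := ⟨mk 1 0⟩

/-- Octonionic conjugation `(q₁, q₂) ↦ (q̄₁, -q₂)`. -/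
instance : Star Octonion := ⟨fun a => mk (star a.fst) (-a.snd)⟩

/-- The inverse `a⁻¹ = |a|⁻² ā` (and `0⁻¹ = 0`). -/
instance : Inv Octonion := ⟨fun a => (‖a‖ ^ 2)⁻¹ • star a⟩

@[ext] theorem ext {a b : Octonion} (h₁ : a.fst = b.fst) (h₂ : a.snd = b.snd) : a = b :=
  WithLp.ofLp_injective 2 (Prod.ext h₁ h₂)

@[simp] theorem fst_mk (p q : Quaternion ℝ) : (mk p q).fst = p := rfl
@[simp] theorem snd_mk (p q : Quaternion ℝ) : (mk p q).snd = q := rfl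
@[simp] theorem fst_zero : (0 : Octonion).fst = 0 := rfl
@[simp] theorem snd_zero : (0 : Octonion).snd = 0 := rfl
@[simp] theorem fst_one : (1 : Octonion).fst = 1 := rfl
@[simp] theorem snd_one : (1 : Octonion).snd = 0 := rfl
@[simp] theorem fst_add (a b : Octonion) : (a + b).fst = a.fst + b.fst := rfl
@[simp] theorem snd_add (a b : Octonion) : (a + b).snd = a.snd + b.snd := rfl
@[simp] theorem fst_smul (r : ℝ) (a : Octonion) : (r • a).fst = r • a.fst := rfl
@[simp] theorem snd_smul (r : ℝ) (a : Octonion) : (r • a).snd = r • a.snd := rfl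
@[simp] theorem fst_star (a : Octonion) : (star a).fst = star a.fst := rfl
@[simp] theorem snd_star (a : Octonion) : (star a).snd = -a.snd := rfl
@[simp] theorem fst_mul (a b : Octonion) :
    (a * b).fst = a.fst * b.fst - star b.snd * a.snd := rfl
@[simp] theorem snd_mul (a b : Octonion) :
    (a * b).snd = b.snd * a.fst + a.snd * star b.fst := rfl

instance : NonAssocRing Octonion :=
  { (inferInstance : AddCommGroup Octonion), (inferInstance : Mul Octonion),
    (inferInstance : One Octonion) with
    left_distrib := fun a b c => by
      ext1 <;> simp only [fst_mul, snd_mul, fst_add, snd_add, star_add, mul_add, add_mul] <;> abel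
    right_distrib := fun a b c => by
      ext1 <;> simp only [fst_mul, snd_mul, fst_add, snd_add, mul_add, add_mul] <;> abel
    zero_mul := fun a => by ext1 <;> simp
    mul_zero := fun a => by ext1 <;> simp
    one_mul := fun a => by ext1 <;> simp
    mul_one := fun a => by ext1 <;> simp }

instance : IsScalarTower ℝ Octonion Octonion :=
  ⟨fun r a b => by ext1 <;> simp [smul_sub, smul_add]⟩

instance : SMulCommClass ℝ Octonion Octonion :=
  ⟨fun r a b => by ext1 <;> simp [smul_sub, smul_add]⟩

theorem re_add (a b : Octonion) : (a + b).re = a.re + b.re := rfl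

theorem re_neg (a : Octonion) : (-a).re = -a.re := rfl

theorem re_smul (r : ℝ) (a : Octonion) : (r • a).re = r * a.re := rfl

theorem star_add' (a b : Octonion) : star (a + b) = star a + star b := by
  ext1 <;> simp [add_comm]

theorem star_smul' (r : ℝ) (a : Octonion) : star (r • a) = r • star a := by
  ext1 <;> simp

/-- The inner product is `⟨a, b⟩ = Re[a b̄]`. -/
theorem inner_eq_re (a b : Octonion) : inner ℝ a b = (a * star b).re := by
  have h : inner ℝ a b = inner ℝ a.fst b.fst + inner ℝ a.snd b.snd := rfl
  rw [h]
  simp only [re, fst_mul, fst_star, snd_star, Quaternion.inner_def]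
  simp
  ring

theorem norm_sq_eq (a : Octonion) : ‖a‖ ^ 2 =
    a.fst.re ^ 2 + a.fst.imI ^ 2 + a.fst.imJ ^ 2 + a.fst.imK ^ 2 +
      (a.snd.re ^ 2 + a.snd.imI ^ 2 + a.snd.imJ ^ 2 + a.snd.imK ^ 2) := by
  rw [← real_inner_self_eq_norm_sq, inner_eq_re]
  simp [re]
  ring

theorem mul_mul_star (a b : Octonion) : a * b * star b = (‖b‖ ^ 2) • a := by
  rw [norm_sq_eq]
  ext <;> simp <;> ring

theorem star_mul_mul (a b : Octonion) : star a * (a * b) = (‖a‖ ^ 2) • b := by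
  rw [norm_sq_eq]
  ext <;> simp <;> ring

theorem star_star' (a : Octonion) : star (star a) = a := by ext1 <;> simp

theorem norm_star' (a : Octonion) : ‖star a‖ ^ 2 = ‖a‖ ^ 2 := by
  rw [norm_sq_eq, norm_sq_eq]; simp

theorem mul_mul_inv {b : Octonion} (a : Octonion) (hb : b ≠ 0) : a * b * b⁻¹ = a := by
  have : ‖b‖ ^ 2 ≠ 0 := by simpa using hb
  change a * b * ((‖b‖ ^ 2)⁻¹ • star b) = a
  rw [mul_smul_comm, mul_mul_star, smul_smul, inv_mul_cancel₀ this, one_smul]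

theorem mul_inv_mul {b : Octonion} (a : Octonion) (hb : b ≠ 0) : a * b⁻¹ * b = a := by
  have : ‖b‖ ^ 2 ≠ 0 := by simpa using hb
  have h := mul_mul_star a (star b)
  rw [star_star', norm_star'] at h
  change a * ((‖b‖ ^ 2)⁻¹ • star b) * b = a
  rw [mul_smul_comm, smul_mul_assoc, h, smul_smul, inv_mul_cancel₀ this, one_smul]

theorem inv_mul_mul {a : Octonion} (b : Octonion) (ha : a ≠ 0) : a⁻¹ * (a * b) = b := by
  have : ‖a‖ ^ 2 ≠ 0 := by simpa using ha
  change (((‖a‖ ^ 2)⁻¹ • star a) : Octonion) * (a * b) = b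
  rw [smul_mul_assoc, star_mul_mul, smul_smul, inv_mul_cancel₀ this, one_smul]

theorem mul_inv_self {a : Octonion} (ha : a ≠ 0) : a * a⁻¹ = 1 := by
  simpa using mul_mul_inv 1 ha

theorem inv_mul_self {a : Octonion} (ha : a ≠ 0) : a⁻¹ * a = 1 := by
  simpa using mul_inv_mul 1 ha

instance : Nontrivial Octonion := ⟨⟨0, 1, fun h => by simpa using congrArg fst h⟩⟩

theorem inv_ne_zero' {a : Octonion} (ha : a ≠ 0) : a⁻¹ ≠ 0 := fun h => by
  have := mul_inv_self ha
  rw [h, mul_zero] at this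
  exact zero_ne_one this

theorem norm_mul_sq (a b : Octonion) : ‖a * b‖ ^ 2 = ‖a‖ ^ 2 * ‖b‖ ^ 2 := by
  rw [norm_sq_eq, norm_sq_eq, norm_sq_eq]; simp; ring

theorem mul_ne_zero' {a b : Octonion} (ha : a ≠ 0) (hb : b ≠ 0) : a * b ≠ 0 := fun h => by
  have := norm_mul_sq a b
  rw [h] at this
  simp [ha, hb] at this

theorem star_mul' (a b : Octonion) : star (a * b) = star b * star a := by
  ext1 <;> simp [neg_mul, mul_neg, add_comm]

theorem mul_inv_rev' (a b : Octonion) : (a * b)⁻¹ = b⁻¹ * a⁻¹ := by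
  change (‖a * b‖ ^ 2)⁻¹ • star (a * b) = ((‖b‖ ^ 2)⁻¹ • star b) * ((‖a‖ ^ 2)⁻¹ • star a)
  rw [norm_mul_sq, star_mul', smul_mul_assoc, mul_smul_comm, smul_smul, mul_inv_rev]

theorem contDiff_mul : ContDiff ℝ ∞ (fun p : Octonion × Octonion => p.1 * p.2) :=
  ((LinearMap.mul ℝ Octonion).toContinuousBilinearMap).isBoundedBilinearMap.contDiff

theorem contDiffOn_inv : ContDiffOn ℝ ∞ (fun a : Octonion => a⁻¹) {a | a ≠ 0} := by
  have hs : ContDiff ℝ ∞ (fun a : Octonion => star a) :=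
    (LinearMap.toContinuousLinearMap
      ({ toFun := fun a => star a
         map_add' := star_add'
         map_smul' := star_smul' } : Octonion →ₗ[ℝ] Octonion)).contDiff
  have hn : ContDiff ℝ ∞ (fun a : Octonion => ‖a‖ ^ 2) := contDiff_norm_sq ℝ
  exact (hn.contDiffOn.inv fun a ha => by simpa using ha).smul hs.contDiffOn

end Octonion

/-- The plane `𝕆²`, the model space of all manifolds below. -/
abbrev OctPlane : Type := Octonion × Octonion

namespace OP2

/-- `[a] ∼ [b]` on `𝕆³`: there is `l ≠ 0` with `aₖ = bₖ l` for `k = 1, 2, 3`. -/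
def Proportional (a b : Fin 3 → Octonion) : Prop :=
  ∃ l : Octonion, l ≠ 0 ∧ ∀ k, a k = b k * l

/-- `𝒰 = U₁ ∪ U₂ ∪ U₃`: triples of octonions at least one of which is `1`. -/
def Reduced : Set (Fin 3 → Octonion) := {a | ∃ i, a i = 1}

theorem proportional_trans {a b c : Fin 3 → Octonion} (ha : a ∈ Reduced) (hb : b ∈ Reduced)
    (hc : c ∈ Reduced) (hab : Proportional a b) (hbc : Proportional b c) :
    Proportional a c := by
  obtain ⟨l, hl, hab⟩ := hab
  obtain ⟨m, hm, hbc⟩ := hbc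
  obtain ⟨i, hi⟩ := hc
  obtain ⟨k, hk⟩ := hb
  obtain ⟨n, hn⟩ := ha
  refine ⟨m * l, Octonion.mul_ne_zero' hm hl, ?_⟩
  have hck : c k * m = 1 := by rw [← hbc, hk]
  have hbn : b n * l = 1 := by rw [← hab, hn]
  have hckinv : c k = m⁻¹ := by
    rw [← Octonion.mul_mul_inv (c k) hm, hck, one_mul]
  have hbninv : b n = l⁻¹ := by
    rw [← Octonion.mul_mul_inv (b n) hl, hbn, one_mul]
  intro j
  rw [hab, hbc]
  by_cases hki : k = i
  · have : m = 1 := by rw [hki, hi, one_mul] at hck; exact hck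
    simp [this]
  by_cases hnk : n = k
  · have : l = 1 := by rw [hnk, hk, one_mul] at hbn; exact hbn
    simp [this]
  by_cases hni : n = i
  · have hml : m * l = 1 := by
      rw [hbc, hni, hi, one_mul] at hbn; exact hbn
    have hlm : l = m⁻¹ := by
      rw [← Octonion.inv_mul_mul l hm, hml, mul_one]
    rw [hml, hlm, Octonion.mul_mul_inv _ hm, mul_one]
  have hj : j = i ∨ j = k ∨ j = n := by omega
  rcases hj with rfl | rfl | rfl
  · rw [hi, one_mul, one_mul]
  · rw [hck, hckinv, Octonion.inv_mul_mul _ hm, one_mul]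
  · have h1 : c j = l⁻¹ * m⁻¹ := by
      rw [← Octonion.mul_mul_inv (c j) hm, ← hbc, hbninv]
    have h2 : (l⁻¹ * m⁻¹) * (m * l) = 1 := by
      have hml := Octonion.mul_ne_zero' hm hl
      rw [← Octonion.mul_inv_rev' m l, Octonion.inv_mul_self hml]
    rw [← hbc, hbn, h1, h2]

/-- The relation `∼` on `𝒰` is an equivalence relation. -/
instance setoid : Setoid Reduced where
  r a b := Proportional a b
  iseqv :=
    { refl := fun a => ⟨1, one_ne_zero, fun k => (mul_one _).symm⟩
      symm := fun {a b} ⟨l, hl, h⟩ => ⟨l⁻¹, Octonion.inv_ne_zero' hl, fun k => by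
        rw [h, Octonion.mul_mul_inv _ hl]⟩
      trans := fun {a b c} h₁ h₂ => proportional_trans a.2 b.2 c.2 h₁ h₂ }

end OP2

/-- The octonionic projective plane `𝕆P² = 𝒰/∼` in reduced homogeneous coordinates. -/
def OP2 : Type := Quotient OP2.setoid

namespace OP2

/-- The triple with `1` in position `i` and the two remaining entries `u, v` in this order. -/
def triple (i : Fin 3) (x : OctPlane) : Fin 3 → Octonion := i.insertNth 1 ![x.1, x.2]

/-- The two entries of a triple that are not in position `i`. -/
def coords (i : Fin 3) (a : Fin 3 → Octonion) : OctPlane := (a (i.succAbove 0), a (i.succAbove 1))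

theorem triple_self (i : Fin 3) (x : OctPlane) : triple i x i = 1 := by simp [triple]

theorem coords_triple (i : Fin 3) (x : OctPlane) : coords i (triple i x) = x := by
  simp [coords, triple]

theorem triple_coords (i : Fin 3) (a : Fin 3 → Octonion) (h : a i = 1) :
    triple i (coords i a) = a := by
  unfold triple coords
  rw [← Fin.insertNth_self_removeNth i a, h]
  congr 1
  ext1 k
  fin_cases k <;> simp [Fin.removeNth]

/-- The inverse of the affine chart `φᵢ`: `(u, v) ↦ [1, u, v]`, `[u, 1, v]`, `[u, v, 1]` for the
three values of `i`. -/
def param (i : Fin 3) (x : OctPlane) : OP2 :=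
  Quotient.mk setoid ⟨triple i x, i, triple_self i x⟩

/-- The change of coordinates `φⱼ ∘ φᵢ⁻¹`. -/
def transition (i j : Fin 3) (x : OctPlane) : OctPlane :=
  coords j fun k => triple i x k * (triple i x j)⁻¹

theorem param_eq_param_iff (i j : Fin 3) (x y : OctPlane) :
    param i x = param j y ↔ triple i x j ≠ 0 ∧ y = transition i j x := by
  constructor
  · intro h
    obtain ⟨l, hl, h⟩ : Proportional (triple i x) (triple j y) := Quotient.exact h
    have hj := h j
    rw [triple_self, one_mul] at hj
    refine ⟨hj ▸ hl, ?_⟩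
    have : (fun k => triple i x k * (triple i x j)⁻¹) = triple j y := by
      funext k
      rw [hj, h k, Octonion.mul_mul_inv _ hl]
    rw [transition, this, coords_triple]
  · rintro ⟨h0, rfl⟩
    refine Quotient.sound ⟨triple i x j, h0, fun k => ?_⟩
    simp only [transition]
    rw [triple_coords, Octonion.mul_inv_mul _ h0]
    exact Octonion.mul_inv_self h0

theorem param_injective (i : Fin 3) : Function.Injective (param i) := fun x y h => by
  rw [((param_eq_param_iff i i x y).1 h).2, transition]
  have : (fun k => triple i x k * (triple i x i)⁻¹) = triple i x := by
    funext k
    rw [triple_self]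
    simpa using Octonion.mul_mul_inv (triple i x k) (one_ne_zero (α := Octonion))
  rw [this, coords_triple]

theorem exists_param (p : OP2) : ∃ i x, param i x = p := by
  induction p using Quotient.inductionOn with
  | h a =>
    obtain ⟨a, i, hi⟩ := a
    exact ⟨i, coords i a, congrArg (Quotient.mk setoid) (Subtype.ext (triple_coords i a hi))⟩

theorem contDiff_triple (i k : Fin 3) : ContDiff ℝ ∞ fun x => triple i x k := by
  rcases Fin.eq_self_or_eq_succAbove i k with rfl | ⟨k, rfl⟩
  · simp only [triple_self]
    exact contDiff_const
  · simp only [triple, Fin.insertNth_apply_succAbove]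
    fin_cases k
    · exact contDiff_fst
    · exact contDiff_snd

theorem contDiffOn_transition (i j : Fin 3) :
    ContDiffOn ℝ ∞ (transition i j) {x | triple i x j ≠ 0} := by
  have hinv : ContDiffOn ℝ ∞ (fun x => (triple i x j)⁻¹) {x | triple i x j ≠ 0} :=
    ContDiffOn.comp (g := fun a : Octonion => a⁻¹) Octonion.contDiffOn_inv
      (contDiff_triple i j).contDiffOn fun x hx => hx
  have h : ∀ k, ContDiffOn ℝ ∞ (fun x => triple i x k * (triple i x j)⁻¹)
      {x | triple i x j ≠ 0} := fun k =>
    ContDiff.comp_contDiffOn (g := fun p : Octonion × Octonion => p.1 * p.2)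
      (f := fun x => (triple i x k, (triple i x j)⁻¹)) Octonion.contDiff_mul
      ((contDiff_triple i k).contDiffOn.prodMk hinv)
  exact (h (j.succAbove 0)).prodMk (h (j.succAbove 1))

theorem isOpen_domain (i j : Fin 3) : IsOpen {x | triple i x j ≠ 0} :=
  isOpen_ne_fun (contDiff_triple i j).continuous continuous_const

/-- The topology glued from the three affine charts: a set is open if and only if its
preimages in all three copies of `𝕆²` are open. -/
instance : TopologicalSpace OP2 := ⨆ i, TopologicalSpace.coinduced (param i) inferInstance

theorem isOpenEmbedding_param (i : Fin 3) : Topology.IsOpenEmbedding (param i) := by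
  refine .of_continuous_injective_isOpenMap ?_ (param_injective i) fun W hW => ?_
  · exact continuous_iff_coinduced_le.2 (le_iSup (fun i =>
      TopologicalSpace.coinduced (param i) inferInstance) i)
  · rw [isOpen_iSup_iff]
    intro j
    rw [isOpen_coinduced]
    have : param j ⁻¹' (param i '' W) = {x | triple j x i ≠ 0} ∩ transition j i ⁻¹' W := by
      ext x
      constructor
      · rintro ⟨w, hw, h⟩
        obtain ⟨h0, rfl⟩ := (param_eq_param_iff j i x w).1 h.symm
        exact ⟨h0, hw⟩
      · rintro ⟨h0, hw⟩
        exact ⟨_, hw, ((param_eq_param_iff j i x _).2 ⟨h0, rfl⟩).symm⟩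
    rw [this]
    exact (contDiffOn_transition j i).continuousOn.isOpen_inter_preimage (isOpen_domain j i) hW

/-- The affine chart `φᵢ : Uᵢ/∼ → 𝕆²`. -/
def chart (i : Fin 3) : OpenPartialHomeomorph OP2 OctPlane :=
  ((isOpenEmbedding_param i).toOpenPartialHomeomorph (param i)).symm

open Classical in
/-- The index of the first affine chart that contains `p`. -/
def chartIndex (p : OP2) : Fin 3 :=
  if p ∈ Set.range (param 0) then 0 else if p ∈ Set.range (param 1) then 1 else 2

theorem mem_range_param_chartIndex (p : OP2) : p ∈ Set.range (param (chartIndex p)) := by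
  unfold chartIndex
  split_ifs with h0 h1
  · exact h0
  · exact h1
  · obtain ⟨i, x, rfl⟩ := exists_param p
    fin_cases i
    · exact absurd ⟨x, rfl⟩ h0
    · exact absurd ⟨x, rfl⟩ h1
    · exact ⟨x, rfl⟩

instance : ChartedSpace OctPlane OP2 where
  atlas := Set.range chart
  chartAt p := chart (chartIndex p)
  mem_chart_source p := by
    simpa [chart] using mem_range_param_chartIndex p
  chart_mem_atlas p := ⟨_, rfl⟩

instance : IsManifold 𝓘(ℝ, OctPlane) ∞ OP2 := by
  refine isManifold_of_contDiffOn _ _ _ ?_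
  rintro _ _ ⟨i, rfl⟩ ⟨j, rfl⟩
  have hsrc : ((chart i).symm ≫ₕ chart j).source ⊆ {x | triple i x j ≠ 0} := by
    intro x hx
    simp only [chart, OpenPartialHomeomorph.symm_symm, OpenPartialHomeomorph.trans_source,
      OpenPartialHomeomorph.symm_source, Topology.IsOpenEmbedding.toOpenPartialHomeomorph_source,
      Topology.IsOpenEmbedding.toOpenPartialHomeomorph_target, Set.univ_inter,
      Topology.IsOpenEmbedding.toOpenPartialHomeomorph_apply] at hx
    obtain ⟨y, hy⟩ := hx
    exact ((param_eq_param_iff i j x y).1 hy.symm).1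
  simp only [modelWithCornersSelf_coe, modelWithCornersSelf_coe_symm, Set.range_id, Set.inter_univ,
    Set.preimage_id_eq, id_eq, CompTriple.comp_eq]
  refine ((contDiffOn_transition i j).mono hsrc).congr fun x hx => ?_
  have h : param i x = param j (transition i j x) :=
    (param_eq_param_iff i j x _).2 ⟨hsrc hx, rfl⟩
  change ((isOpenEmbedding_param j).toOpenPartialHomeomorph (param j)).symm (param i x) = _
  rw [h]
  exact (isOpenEmbedding_param j).toOpenPartialHomeomorph_left_inv (param j)

end OP2

section Riemannian

variable {E : Type*} [NormedAddCommGroup E] [NormedSpace ℝ E]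

/-- The Christoffel symbols of the first kind of the metric `G` on (an open subset of) `E`, as the
linear form `c ↦ ½ (∂_a G(b, c) + ∂_b G(a, c) - ∂_c G(a, b))`. -/
def christoffelFirst (G : E → E →L[ℝ] E →L[ℝ] ℝ) (x a b : E) : E →L[ℝ] ℝ :=
  (1 / 2 : ℝ) • (fderiv ℝ G x a b + fderiv ℝ G x b a - ((fderiv ℝ G x).flip a).flip b)

/-- The Christoffel symbols of the second kind: `G (Γ(a, b), c) = christoffelFirst G x a b c` for
all `c`, whenever `G x` is non-degenerate. -/
def christoffel (G : E → E →L[ℝ] E →L[ℝ] ℝ) (x a b : E) : E :=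
  (G x).inverse (christoffelFirst G x a b)

/-- The curvature operator in coordinates, with the sign convention
`R(a, b)c = ∂_b Γ(a, c) - ∂_a Γ(b, c) + Γ(b, Γ(a, c)) - Γ(a, Γ(b, c))`. -/
def coordCurvature (G : E → E →L[ℝ] E →L[ℝ] ℝ) (x a b c : E) : E :=
  fderiv ℝ (fun y => christoffel G y a c) x b - fderiv ℝ (fun y => christoffel G y b c) x a
    + christoffel G x b (christoffel G x a c) - christoffel G x a (christoffel G x b c)

variable {M : Type*} [TopologicalSpace M] [ChartedSpace E M]

/-- The coordinate expression, in the preferred chart at `p`, of a field `g` of bilinear forms on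
the tangent spaces of `M`: its pullback under the inverse of the chart. -/
def chartMetric
    (g : ∀ q : M, TangentSpace 𝓘(ℝ, E) q →L[ℝ] TangentSpace 𝓘(ℝ, E) q →L[ℝ] ℝ)
    (p : M) (x : E) : E →L[ℝ] E →L[ℝ] ℝ :=
  let G : E →L[ℝ] E →L[ℝ] ℝ := g ((chartAt E p).symm x)
  let D : E →L[ℝ] E := mfderiv 𝓘(ℝ, E) 𝓘(ℝ, E) (chartAt E p).symm x
  G.bilinearComp D D

/-- The Riemann curvature tensor `R(a, b, c, d) = g(R(a, b)c, d)` of `g` at `p`. The tangent space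
at `p` is identified with `E` by the preferred chart at `p`. -/
def riemannCurvature
    (g : ∀ q : M, TangentSpace 𝓘(ℝ, E) q →L[ℝ] TangentSpace 𝓘(ℝ, E) q →L[ℝ] ℝ)
    (p : M) (a b c d : TangentSpace 𝓘(ℝ, E) p) : ℝ :=
  g p (coordCurvature (E := E) (chartMetric g p) (chartAt E p p) a b c) d

/-- A diffeomorphism that preserves `g`. -/
def IsMetricIsometry
    (g : ∀ q : M, TangentSpace 𝓘(ℝ, E) q →L[ℝ] TangentSpace 𝓘(ℝ, E) q →L[ℝ] ℝ)
    (f : M ≃ₘ^∞⟮𝓘(ℝ, E), 𝓘(ℝ, E)⟯ M) : Prop :=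
  ∀ (q : M) (v w : TangentSpace 𝓘(ℝ, E) q),
    g (f q) (mfderiv 𝓘(ℝ, E) 𝓘(ℝ, E) f q v) (mfderiv 𝓘(ℝ, E) 𝓘(ℝ, E) f q w) = g q v w

/-- The isometries of `g` act transitively. -/
def IsHomogeneousMetric
    (g : ∀ q : M, TangentSpace 𝓘(ℝ, E) q →L[ℝ] TangentSpace 𝓘(ℝ, E) q →L[ℝ] ℝ) : Prop :=
  ∀ p q : M, ∃ f : M ≃ₘ^∞⟮𝓘(ℝ, E), 𝓘(ℝ, E)⟯ M, IsMetricIsometry g f ∧ f p = q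

end Riemannian

/-- The symmetric bilinear form on `𝕆²` whose quadratic form is
`(du, dv) ↦ α |du|² + β |dv|² + 2 Re[q (dv dū)]`. -/
def planeForm (α β : ℝ) (q : Octonion) : OctPlane →L[ℝ] OctPlane →L[ℝ] ℝ :=
  (LinearMap.mk₂ ℝ (fun X Y : OctPlane =>
      α * inner ℝ X.1 Y.1 + β * inner ℝ X.2 Y.2
        + ((q * (X.2 * star Y.1)).re + (q * (Y.2 * star X.1)).re))
    (fun X X' Y => by
      simp only [Prod.fst_add, Prod.snd_add, inner_add_left, Octonion.star_add', add_mul, mul_add,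
        Octonion.re_add]
      ring)
    (fun r X Y => by
      simp only [Prod.smul_fst, Prod.smul_snd, real_inner_smul_left, Octonion.star_smul',
        smul_mul_assoc, mul_smul_comm, Octonion.re_smul, smul_eq_mul]
      ring)
    (fun X Y Y' => by
      simp only [Prod.fst_add, Prod.snd_add, inner_add_right, Octonion.star_add', add_mul, mul_add,
        Octonion.re_add]
      ring)
    (fun r X Y => by
      simp only [Prod.smul_fst, Prod.smul_snd, real_inner_smul_right, Octonion.star_smul',
        smul_mul_assoc, mul_smul_comm, Octonion.re_smul, smul_eq_mul]
      ring)).toContinuousBilinearMap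

theorem planeForm_self (α β : ℝ) (q : Octonion) (X : OctPlane) :
    planeForm α β q X X
      = α * ‖X.1‖ ^ 2 + β * ‖X.2‖ ^ 2 + 2 * (q * (X.2 * star X.1)).re := by
  simp only [planeForm, LinearMap.toContinuousBilinearMap_apply, LinearMap.mk₂_apply,
    real_inner_self_eq_norm_sq]
  ring

/-- The metric of `𝕆P²` in an affine chart, at the point with coordinates `(u, v)`. -/
def projForm (x : OctPlane) : OctPlane →L[ℝ] OctPlane →L[ℝ] ℝ :=
  ((1 + ‖x.1‖ ^ 2 + ‖x.2‖ ^ 2) ^ 2)⁻¹ •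
    planeForm (1 + ‖x.2‖ ^ 2) (1 + ‖x.1‖ ^ 2) (-(x.1 * star x.2))

/-- `ds² = (|du|²(1+|v|²) + |dv|²(1+|u|²) - 2Re[(u v̄)(dv dū)]) / (1+|u|²+|v|²)²`. -/
theorem projForm_self (u v du dv : Octonion) :
    projForm (u, v) (du, dv) (du, dv)
      = (‖du‖ ^ 2 * (1 + ‖v‖ ^ 2) + ‖dv‖ ^ 2 * (1 + ‖u‖ ^ 2)
          - 2 * ((u * star v) * (dv * star du)).re) / (1 + ‖u‖ ^ 2 + ‖v‖ ^ 2) ^ 2 := by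
  simp only [projForm, smul_apply, planeForm_self, neg_mul, Octonion.re_neg,
    smul_eq_mul, div_eq_inv_mul]
  ring

/-- The metric of `𝕆H²` at the point `(u, v)`. -/
def hypForm (x : OctPlane) : OctPlane →L[ℝ] OctPlane →L[ℝ] ℝ :=
  ((1 - ‖x.1‖ ^ 2 - ‖x.2‖ ^ 2) ^ 2)⁻¹ •
    planeForm (1 - ‖x.2‖ ^ 2) (1 - ‖x.1‖ ^ 2) (x.1 * star x.2)

/-- `ds² = (|du|²(1-|v|²) + |dv|²(1-|u|²) + 2Re[(u v̄)(dv dū)]) / (1-|u|²-|v|²)²`. -/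
theorem hypForm_self (u v du dv : Octonion) :
    hypForm (u, v) (du, dv) (du, dv)
      = (‖du‖ ^ 2 * (1 - ‖v‖ ^ 2) + ‖dv‖ ^ 2 * (1 - ‖u‖ ^ 2)
          + 2 * ((u * star v) * (dv * star du)).re) / (1 - ‖u‖ ^ 2 - ‖v‖ ^ 2) ^ 2 := by
  simp only [hypForm, smul_apply, planeForm_self, smul_eq_mul, div_eq_inv_mul]
  ring

/-- The metric of `𝕆P²`, given by the same formula in each affine chart. The tangent space at `p` is
identified with `𝕆²` by the preferred affine chart at `p`, which is the chart `[1, u, v] ↦ (u, v)`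
at every point of the form `[1, u, v]`. -/
def OP2.metric (p : OP2) :
    TangentSpace 𝓘(ℝ, OctPlane) p →L[ℝ] TangentSpace 𝓘(ℝ, OctPlane) p →L[ℝ] ℝ :=
  projForm (chartAt OctPlane p p)

/-- The point `[1, 0, 0]`. -/
def OP2.basePoint : OP2 := OP2.param 0 (0, 0)

/-- The octonionic hyperbolic plane: the open unit ball `|u|² + |v|² < 1` of `𝕆²`, with the smooth
structure of an open subset. -/
def OH2 : TopologicalSpace.Opens OctPlane where
  carrier := {x | ‖x.1‖ ^ 2 + ‖x.2‖ ^ 2 < 1}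
  is_open' := isOpen_lt (by fun_prop) continuous_const

/-- The metric of `𝕆H²`. -/
def OH2.metric (p : OH2) :
    TangentSpace 𝓘(ℝ, OctPlane) p →L[ℝ] TangentSpace 𝓘(ℝ, OctPlane) p →L[ℝ] ℝ :=
  hypForm p

/-- The point `(0, 0)`. -/
def OH2.origin : OH2 := ⟨(0, 0), by simp [OH2]⟩

end

/-!
Homogeneity. The kernel `coshSqDist` is the octonionic form of the squared hyperbolic cosine of the
distance, and near the diagonal it is `1` plus the metric up to higher order, so that a smooth map
which preserves the kernel is an isometry. It is preserved by the coordinate swap and by the boosts: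
these extend the Möbius involutions of the first coordinate, and the boost with parameter `a` takes
`(a, 0)` to the origin. A boost takes a given point to one of the form `(0, b)`, the swap takes this
to `(b, 0)`, and another boost to the origin.

Curvature. In affine coordinates both metrics have the form `(1 + ε N)⁻² (P + ε Q)` with constant
`P` and quadratic `N`, `Q`, where `ε = 1` for `𝕆P²` and `ε = -1` for `𝕆H²`. The first derivatives,
and with them the Christoffel symbols, vanish at the origin, so the curvature there is linear in the
second derivatives, which are proportional to `ε`.
-/

/-! ### Octonion identities -/

namespace Octonion

theorem re_mul_comm (a b : Octonion) : (a * b).re = (b * a).re := by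
  simp only [re, fst_mul, Quaternion.re_sub, Quaternion.re_mul, Quaternion.re_star,
    Quaternion.imI_star, neg_mul, sub_neg_eq_add, Quaternion.imJ_star, Quaternion.imK_star]
  ring

theorem re_mul_assoc (a b c : Octonion) : (a * b * c).re = (a * (b * c)).re := by
  simp only [re, fst_mul, snd_mul, Quaternion.re_sub, Quaternion.re_mul, Quaternion.re_star,
    Quaternion.imI_star, neg_mul, sub_neg_eq_add, Quaternion.imJ_star, Quaternion.imK_star,
    Quaternion.imI_sub, Quaternion.imI_mul, Quaternion.imJ_sub, Quaternion.imJ_mul,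
    Quaternion.imK_sub, Quaternion.imK_mul, Quaternion.re_add, mul_neg, Quaternion.imI_add,
    Quaternion.imJ_add, Quaternion.imK_add, star_add, star_mul, star_star, neg_neg]
  ring

theorem re_mul_eq_inner (a b : Octonion) : (a * b).re = inner ℝ a (star b) := by
  rw [inner_eq_re, star_star']

theorem inner_star_star (a b : Octonion) : inner ℝ (star a) (star b) = (inner ℝ a b : ℝ) := by
  rw [inner_eq_re, star_star', re_mul_comm, ← inner_eq_re, real_inner_comm]

theorem inner_mul_right (a b c : Octonion) :
    inner ℝ (a * b) c = (inner ℝ a (c * star b) : ℝ) := by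
  rw [inner_eq_re, inner_eq_re, star_mul', star_star', re_mul_assoc]

theorem inner_mul_left (a b c : Octonion) :
    inner ℝ (a * b) c = (inner ℝ b (star a * c) : ℝ) := by
  rw [inner_eq_re, inner_eq_re, star_mul', star_star', re_mul_assoc, re_mul_comm, re_mul_assoc]

theorem inner_mul_mul_left (a b c : Octonion) :
    inner ℝ (a * b) (a * c) = (‖a‖ ^ 2 * inner ℝ b c : ℝ) := by
  rw [inner_mul_left, star_mul_mul, real_inner_smul_right]

theorem inner_mul_mul_right (a b c : Octonion) :
    inner ℝ (a * c) (b * c) = (‖c‖ ^ 2 * inner ℝ a b : ℝ) := by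
  rw [inner_mul_right, mul_mul_star, real_inner_smul_right]

theorem star_sub' (a b : Octonion) : star (a - b) = star a - star b := by
  rw [eq_sub_iff_add_eq, ← star_add', sub_add_cancel]

theorem self_mul_star_mul (a b : Octonion) : a * (star a * b) = (‖a‖ ^ 2) • b := by
  have h := star_mul_mul (star a) b
  rwa [star_star', norm_star'] at h

theorem mul_star_mul_self (a b : Octonion) : a * star b * b = (‖b‖ ^ 2) • a := by
  have h := mul_mul_star a (star b)
  rwa [star_star', norm_star'] at h

theorem mul_star_mul_add_mul_star_mul (a b c : Octonion) :
    a * (star b * c) + b * (star a * c) = (2 * inner ℝ a b : ℝ) • c := by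
  have h := self_mul_star_mul (a + b) c
  rw [norm_add_sq_real, star_add', add_mul, add_mul, mul_add, mul_add, self_mul_star_mul,
    self_mul_star_mul] at h
  linear_combination (norm := module) h

theorem inner_mul_mul_add_inner_mul_mul (a b c d : Octonion) :
    inner ℝ (a * c) (b * d) + inner ℝ (a * d) (b * c)
      = (2 * inner ℝ a b * inner ℝ c d : ℝ) := by
  have h := inner_mul_mul_right a b (c + d)
  rw [mul_add, mul_add, inner_add_left, inner_add_right, inner_add_right, inner_mul_mul_right,
    inner_mul_mul_right, norm_add_sq_real] at h
  linear_combination h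

theorem contDiff_star {n : WithTop ℕ∞} : ContDiff ℝ n (star : Octonion → Octonion) :=
  (LinearMap.toContinuousLinearMap
    { toFun := fun a : Octonion => star a
      map_add' := Octonion.star_add'
      map_smul' := Octonion.star_smul' }).contDiff

theorem finrank_eq_eight : Module.finrank ℝ Octonion = 8 := by
  change Module.finrank ℝ (WithLp 2 (Quaternion ℝ × Quaternion ℝ)) = 8
  rw [(WithLp.linearEquiv 2 ℝ (Quaternion ℝ × Quaternion ℝ)).finrank_eq, Module.finrank_prod,
    Quaternion.finrank_eq_four]

end Octonion

theorem finrank_octPlane : Module.finrank ℝ OctPlane = 16 := by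
  rw [Module.finrank_prod, Octonion.finrank_eq_eight]

/-! ### Möbius involutions of the unit ball -/

section Moebius

variable {V : Type*} [NormedAddCommGroup V] [InnerProductSpace ℝ V]

/-- The denominator of `moebius a u`; in the complex plane it is `|1 - ā u|²`. -/
noncomputable def moebiusDen (a u : V) : ℝ := 1 - 2 * inner ℝ a u + ‖a‖ ^ 2 * ‖u‖ ^ 2

/-- The involutive Möbius transformation of the unit ball of `V` that exchanges `a` and `0`; in the
complex plane it is `u ↦ (a - u) / (1 - ā u)`. -/
noncomputable def moebius (a u : V) : V :=
  (moebiusDen a u)⁻¹ • ((1 + ‖u‖ ^ 2 - 2 * inner ℝ a u) • a - (1 - ‖a‖ ^ 2) • u)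

theorem moebiusDen_eq_norm_sub_sq_add (a u : V) :
    moebiusDen a u = ‖a - u‖ ^ 2 + (1 - ‖a‖ ^ 2) * (1 - ‖u‖ ^ 2) := by
  rw [moebiusDen, norm_sub_sq_real]
  ring

variable {a : V}

theorem moebiusDen_pos (ha : ‖a‖ ^ 2 < 1) {u : V} (hu : ‖u‖ ^ 2 < 1) : 0 < moebiusDen a u := by
  rw [moebiusDen_eq_norm_sub_sq_add]
  nlinarith [sq_nonneg ‖a - u‖, mul_pos (sub_pos.2 ha) (sub_pos.2 hu)]

@[simp] theorem moebius_self (a : V) : moebius a a = 0 := by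
  rw [moebius, real_inner_self_eq_norm_sq, ← sub_smul,
    show 1 + ‖a‖ ^ 2 - 2 * ‖a‖ ^ 2 - (1 - ‖a‖ ^ 2) = 0 by ring, zero_smul, smul_zero]

theorem norm_moebius_sq {u : V} (hu : moebiusDen a u ≠ 0) :
    ‖moebius a u‖ ^ 2 = ‖a - u‖ ^ 2 / moebiusDen a u := by
  rw [moebius, norm_smul, mul_pow, norm_sub_sq_real]
  simp only [norm_smul, mul_pow, Real.norm_eq_abs, sq_abs, real_inner_smul_left,
    real_inner_smul_right]
  field_simp
  simp only [moebiusDen, norm_sub_sq_real]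
  ring

theorem moebiusDen_moebius_moebius {u w : V} (hu : moebiusDen a u ≠ 0)
    (hw : moebiusDen a w ≠ 0) :
    moebiusDen (moebius a u) (moebius a w)
      = (1 - ‖a‖ ^ 2) ^ 2 * moebiusDen u w / (moebiusDen a u * moebiusDen a w) := by
  rw [moebiusDen, norm_moebius_sq hu, norm_moebius_sq hw, moebius, moebius]
  simp only [real_inner_smul_left, real_inner_smul_right, inner_sub_left, inner_sub_right,
    real_inner_self_eq_norm_sq, real_inner_comm a u]
  field_simp
  simp only [moebiusDen, norm_sub_sq_real]
  ring

theorem one_sub_norm_moebius_sq {u : V} (hu : moebiusDen a u ≠ 0) :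
    1 - ‖moebius a u‖ ^ 2 = (1 - ‖a‖ ^ 2) * (1 - ‖u‖ ^ 2) / moebiusDen a u := by
  rw [norm_moebius_sq hu]
  field_simp
  rw [moebiusDen_eq_norm_sub_sq_add]
  ring

theorem moebiusDen_moebius {u : V} (hu : moebiusDen a u ≠ 0) :
    moebiusDen a (moebius a u) = (1 - ‖a‖ ^ 2) ^ 2 / moebiusDen a u := by
  rw [moebiusDen, norm_moebius_sq hu, moebius, real_inner_smul_right, inner_sub_right,
    real_inner_smul_right, real_inner_smul_right, real_inner_self_eq_norm_sq]
  field_simp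
  rw [norm_sub_sq_real, moebiusDen]
  ring

theorem moebius_moebius (ha : ‖a‖ ^ 2 < 1) {u : V} (hu : ‖u‖ ^ 2 < 1) :
    moebius a (moebius a u) = u := by
  have hδ := (moebiusDen_pos ha hu).ne'
  have hα : 1 - ‖a‖ ^ 2 ≠ 0 := (sub_pos.2 ha).ne'
  have hcoeff : 1 + ‖moebius a u‖ ^ 2 - 2 * inner ℝ a (moebius a u)
      = (1 - ‖a‖ ^ 2) * (1 + ‖u‖ ^ 2 - 2 * inner ℝ a u) / moebiusDen a u := by
    rw [norm_moebius_sq hδ, moebius, real_inner_smul_right, inner_sub_right,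
      real_inner_smul_right, real_inner_smul_right, real_inner_self_eq_norm_sq]
    field_simp
    rw [norm_sub_sq_real, moebiusDen]
    ring
  rw [moebius, moebiusDen_moebius hδ, hcoeff, moebius]
  match_scalars
  · field_simp
    ring
  · field_simp

theorem contDiffAt_moebiusDen_inv {n : WithTop ℕ∞} {u : V} (h : moebiusDen a u ≠ 0) :
    ContDiffAt ℝ n (fun w => (moebiusDen a w)⁻¹) u := by
  have hinner : ContDiff ℝ n fun w => inner ℝ a w := contDiff_const.inner ℝ contDiff_id
  exact ContDiffAt.inv ((contDiff_const.sub (contDiff_const.mul hinner)).add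
    (contDiff_const.mul (contDiff_norm_sq ℝ))).contDiffAt h

theorem contDiffAt_moebius {n : WithTop ℕ∞} {u : V} (h : moebiusDen a u ≠ 0) :
    ContDiffAt ℝ n (moebius a) u := by
  have hinner : ContDiff ℝ n fun w => inner ℝ a w := contDiff_const.inner ℝ contDiff_id
  exact (contDiffAt_moebiusDen_inv h).smul
    ((((contDiff_const.add (contDiff_norm_sq ℝ)).sub (contDiff_const.mul hinner)).smul
      contDiff_const).sub (contDiff_id.const_smul _)).contDiffAt

end Moebius

/-! ### Metrics on open subsets and homogeneity -/

section Opens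

open TopologicalSpace

theorem chartAt_opens_target {E : Type*} [TopologicalSpace E] {U : Opens E} (p : U) :
    (chartAt E p).target = U := by
  ext y
  constructor
  · intro hy
    rw [← (chartAt E p).right_inv hy]
    exact ((chartAt E p).symm y).2
  · intro hy
    have : (⟨y, hy⟩ : U) ∈ (chartAt E p).source := mem_chart_source E (⟨y, hy⟩ : U)
    exact (chartAt E p).map_source this

theorem coe_chartAt_opens_symm {E : Type*} [TopologicalSpace E] {U : Opens E} (p : U) {y : E}
    (hy : y ∈ U) : ((chartAt E p).symm y : E) = y := by
  have : y ∈ (chartAt E p).target := by rwa [chartAt_opens_target]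
  exact (chartAt E p).right_inv this

variable {E : Type*} [NormedAddCommGroup E] [NormedSpace ℝ E] {U : Opens E}

theorem hasMFDerivAt_opens_of_coe_eq {f : U → U} {F : E → E} {F' : E →L[ℝ] E} {q : U}
    (h : ∀ q : U, (f q : E) = F q) (hF : HasFDerivAt F F' q) :
    HasMFDerivAt 𝓘(ℝ, E) 𝓘(ℝ, E) f q F' := by
  constructor
  · rw [Topology.IsInducing.subtypeVal.continuousAt_iff]
    have hc : ContinuousAt (fun q : U => F q) q :=
      ContinuousAt.comp (g := F) hF.continuousAt continuousAt_subtype_val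
    exact hc.congr (Filter.Eventually.of_forall fun q => (h q).symm)
  · refine (hF.congr_of_eventuallyEq ?_).hasFDerivWithinAt
    filter_upwards [U.isOpen.mem_nhds q.2] with y hy
    change (f ((chartAt E q).symm y) : E) = F y
    rw [h, coe_chartAt_opens_symm q hy]

theorem contMDiff_opens_of_coe_eq {f : U → U} {F : E → E}
    (h : ∀ q : U, (f q : E) = F q) (hF : ∀ x ∈ U, ContDiffAt ℝ ∞ F x) :
    ContMDiff 𝓘(ℝ, E) 𝓘(ℝ, E) ∞ f := by
  rw [← ContMDiff.subtypeVal_comp_iff]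
  intro q
  have : Subtype.val ∘ f = fun q : U => F q := funext h
  rw [this]
  exact contMDiffAt_subtype_iff.2 (hF q q.2).contMDiffAt

theorem contMDiff_opens_bilinForm_section {n : WithTop ℕ∞}
    (g : ∀ p : U, TangentSpace 𝓘(ℝ, E) p →L[ℝ] TangentSpace 𝓘(ℝ, E) p →L[ℝ] ℝ)
    {G : E → E →L[ℝ] E →L[ℝ] ℝ} (h : ∀ (p : U) (v w : E), g p v w = G p v w)
    (hG : ∀ x ∈ U, ContDiffAt ℝ n G x) :
    ContMDiff 𝓘(ℝ, E) (𝓘(ℝ, E).prod 𝓘(ℝ, E →L[ℝ] E →L[ℝ] ℝ)) n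
      (fun p : U => Bundle.TotalSpace.mk' (E →L[ℝ] E →L[ℝ] ℝ)
        (E := fun p : U =>
          TangentSpace 𝓘(ℝ, E) p →L[ℝ] TangentSpace 𝓘(ℝ, E) p →L[ℝ] ℝ) p (g p)) := by
  intro p
  rw [Bundle.contMDiffAt_section]
  have hGp : ContMDiffAt 𝓘(ℝ, E) 𝓘(ℝ, E →L[ℝ] E →L[ℝ] ℝ) n (fun q : U => G q) p :=
    contMDiffAt_subtype_iff.2 (hG p p.2).contMDiffAt
  refine hGp.congr_of_eventuallyEq (Filter.Eventually.of_forall fun q => ?_)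
  ext v w
  have hq : q ∈ (chartAt E p).source := mem_chart_source E q
  have hsymmL : ∀ z : E, (trivializationAt E (TangentSpace 𝓘(ℝ, E)) p).symmL ℝ q z = z := by
    rw [TangentBundle.symmL_trivializationAt_eq_core hq]
    exact (tangentBundleCore 𝓘(ℝ, E) U).coordChange_self (achart E p) q hq
  have hsymm : ∀ z : E, (trivializationAt E (TangentSpace 𝓘(ℝ, E)) p).symm q z = z := fun z => by
    rw [← Bundle.Trivialization.symmL_apply (R := ℝ) _ (by exact hq)]
    exact hsymmL z
  rw [← h]
  simp only [hom_trivializationAt_apply]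
  rw [inCoordinates_apply_eq₂ (by exact hq) (by exact hq) (by exact Set.mem_univ q), hsymm, hsymm]
  simp

end Opens

namespace IsMetricIsometry

variable {E : Type*} [NormedAddCommGroup E] [NormedSpace ℝ E]
  {M : Type*} [TopologicalSpace M] [ChartedSpace E M]
  {g : ∀ q : M, TangentSpace 𝓘(ℝ, E) q →L[ℝ] TangentSpace 𝓘(ℝ, E) q →L[ℝ] ℝ}

theorem trans {f₁ f₂ : M ≃ₘ^∞⟮𝓘(ℝ, E), 𝓘(ℝ, E)⟯ M}
    (h₁ : IsMetricIsometry g f₁) (h₂ : IsMetricIsometry g f₂) :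
    IsMetricIsometry g (f₁.trans f₂) := fun q v w => by
  have h := mfderiv_comp q (f₂.mdifferentiable (by simp) (f₁ q)) (f₁.mdifferentiable (by simp) q)
  rw [Diffeomorph.coe_trans, h]
  exact (h₂ _ _ _).trans (h₁ _ _ _)

theorem symm {f : M ≃ₘ^∞⟮𝓘(ℝ, E), 𝓘(ℝ, E)⟯ M} (h : IsMetricIsometry g f) :
    IsMetricIsometry g f.symm := fun q v w => by
  have hc := mfderiv_comp q (f.mdifferentiable (by simp) (f.symm q))
    (f.symm.mdifferentiable (by simp) q)
  have hid : f ∘ f.symm = id := funext f.apply_symm_apply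
  rw [hid, mfderiv_id] at hc
  have hv : ∀ v : E, mfderiv 𝓘(ℝ, E) 𝓘(ℝ, E) f (f.symm q)
      (mfderiv 𝓘(ℝ, E) 𝓘(ℝ, E) f.symm q v) = v := fun v => (DFunLike.congr_fun hc v).symm
  have hq : ∀ p, p = q → ∀ v w v' w' : E, v' = v → w' = w → g p v' w' = g q v w := by
    rintro p rfl v w _ _ rfl rfl
    rfl
  rw [← h]
  exact hq _ (f.apply_symm_apply q) _ _ _ _ (hv v) (hv w)

end IsMetricIsometry

theorem isHomogeneousMetric_of_forall_exists {E : Type*} [NormedAddCommGroup E] [NormedSpace ℝ E]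
    {M : Type*} [TopologicalSpace M] [ChartedSpace E M]
    {g : ∀ q : M, TangentSpace 𝓘(ℝ, E) q →L[ℝ] TangentSpace 𝓘(ℝ, E) q →L[ℝ] ℝ} {o : M}
    (h : ∀ p, ∃ f : M ≃ₘ^∞⟮𝓘(ℝ, E), 𝓘(ℝ, E)⟯ M, IsMetricIsometry g f ∧ f p = o) :
    IsHomogeneousMetric g := fun p q => by
  obtain ⟨f, hf, hp⟩ := h p
  obtain ⟨k, hk, hq⟩ := h q
  refine ⟨f.trans k.symm, hf.trans hk.symm, ?_⟩
  rw [Diffeomorph.coe_trans, Function.comp_apply, hp, ← hq, k.symm_apply_apply]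

/-! ### Second derivatives at critical points -/

/-- The continuous bilinear maps from `E × E` to `F`. -/
abbrev ContBilinMap (E F : Type*) [NormedAddCommGroup E] [NormedSpace ℝ E] [NormedAddCommGroup F]
    [NormedSpace ℝ F] : Type _ :=
  E →L[ℝ] E →L[ℝ] F

/-- The map `f` is of class `C²` at its critical point `x`, and its second derivative there is the
bilinear map `H`. At a critical point second derivatives obey first-order calculus rules. -/
structure HasCriticalHessianAt {E F : Type*} [NormedAddCommGroup E] [NormedSpace ℝ E]
    [NormedAddCommGroup F] [NormedSpace ℝ F] (f : E → F) (H : ContBilinMap E F) (x : E) : Prop where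
  contDiffAt : ContDiffAt ℝ 2 f x
  hasFDerivAt : HasFDerivAt f (0 : E →L[ℝ] F) x
  hasFDerivAt_fderiv : HasFDerivAt (fderiv ℝ f) H x

namespace HasCriticalHessianAt

variable {E F : Type*} [NormedAddCommGroup E] [NormedSpace ℝ E] [NormedAddCommGroup F]
  [NormedSpace ℝ F] {f g : E → F} {H : ContBilinMap E F} {x : E}

theorem congr_of_eventuallyEq (h : HasCriticalHessianAt f H x) (hg : g =ᶠ[𝓝 x] f) :
    HasCriticalHessianAt g H x :=
  ⟨h.contDiffAt.congr_of_eventuallyEq hg, h.hasFDerivAt.congr_of_eventuallyEq hg,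
    h.hasFDerivAt_fderiv.congr_of_eventuallyEq hg.fderiv⟩

theorem symmetric (h : HasCriticalHessianAt f H x) (a b : E) : H a b = H b a := by
  have hsymm := h.contDiffAt.isSymmSndFDerivAt (by simp)
  rw [IsSymmSndFDerivAt, h.hasFDerivAt_fderiv.fderiv] at hsymm
  exact hsymm a b

theorem of_bilinear (B : ContBilinMap E F) :
    HasCriticalHessianAt (fun y => B y y) (B + B.flip) 0 := by
  have hB : ∀ y, HasFDerivAt (fun y => B y y) ((B + B.flip) y) y := fun y =>
    B.hasFDerivAt_of_bilinear (hasFDerivAt_id y) (hasFDerivAt_id y)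
  refine ⟨?_, ?_, ?_⟩
  · exact (B.isBoundedBilinearMap.contDiff.comp (contDiff_id.prodMk contDiff_id)).contDiffAt
  · simpa only [map_zero] using hB 0
  · rw [show fderiv ℝ (fun y => B y y) = B + B.flip from funext fun y => (hB y).fderiv]
    exact (B + B.flip).hasFDerivAt

theorem const_add (h : HasCriticalHessianAt f H x) (c : F) :
    HasCriticalHessianAt (fun y => c + f y) H x :=
  ⟨contDiffAt_const.add h.contDiffAt, h.hasFDerivAt.const_add c,
    h.hasFDerivAt_fderiv.congr_of_eventuallyEq <|
      Filter.Eventually.of_forall fun _ => fderiv_const_add c⟩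

theorem const_smul (h : HasCriticalHessianAt f H x) (c : ℝ) :
    HasCriticalHessianAt (fun y => c • f y) (c • H) x := by
  refine ⟨contDiffAt_const.smul h.contDiffAt, ?_, ?_⟩
  · simpa only [smul_zero] using h.hasFDerivAt.fun_const_smul c
  · rw [show fderiv ℝ (fun y => c • f y) = c • fderiv ℝ f from fderiv_const_smul_field c]
    exact h.hasFDerivAt_fderiv.const_smul c

theorem comp_left {φ : E → ℝ} {K : ContBilinMap E ℝ} (h : HasCriticalHessianAt φ K x) {k : ℝ → ℝ}
    (hk : ContDiffAt ℝ 2 k (φ x)) :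
    HasCriticalHessianAt (fun y => k (φ y)) (deriv k (φ x) • K) x := by
  have hderiv : ∀ᶠ y in 𝓝 x, HasFDerivAt (fun y => k (φ y)) (deriv k (φ y) • fderiv ℝ φ y) y := by
    filter_upwards [h.contDiffAt.eventually (by simp),
      h.contDiffAt.continuousAt.eventually (hk.eventually (by simp))] with y hφ hk
    exact (hk.differentiableAt (by simp)).hasDerivAt.comp_hasFDerivAt y
      (hφ.differentiableAt (by simp)).hasFDerivAt
  refine ⟨hk.comp x h.contDiffAt, ?_, ?_⟩
  · simpa only [h.hasFDerivAt.fderiv, smul_zero] using hderiv.self_of_nhds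
  · have hk' : DifferentiableAt ℝ (deriv k) (φ x) :=
      (hk.derivWithin (m := 1) (by norm_num)).differentiableAt (by simp)
    refine HasFDerivAt.congr_of_eventuallyEq ?_ (hderiv.mono fun y hy => hy.fderiv)
    refine ((hk'.hasFDerivAt.comp x h.hasFDerivAt).smul h.hasFDerivAt_fderiv).congr_fderiv ?_
    simp

theorem smul {φ : E → ℝ} {K : ContBilinMap E ℝ} (hφ : HasCriticalHessianAt φ K x)
    (hf : HasCriticalHessianAt f H x) :
    HasCriticalHessianAt (fun y => φ y • f y)
      (φ x • H + ((ContinuousLinearMap.smulRightL ℝ E F).flip (f x)).comp K) x := by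
  have hderiv : ∀ᶠ y in 𝓝 x, HasFDerivAt (fun y => φ y • f y)
      (φ y • fderiv ℝ f y + ContinuousLinearMap.smulRightL ℝ E F (fderiv ℝ φ y) (f y)) y := by
    filter_upwards [hφ.contDiffAt.eventually (by simp), hf.contDiffAt.eventually (by simp)]
      with y hφ hf
    exact (hφ.differentiableAt (by simp)).hasFDerivAt.smul
      (hf.differentiableAt (by simp)).hasFDerivAt
  refine ⟨hφ.contDiffAt.smul hf.contDiffAt, ?_, ?_⟩
  · simpa only [hφ.hasFDerivAt.fderiv, hf.hasFDerivAt.fderiv, smul_zero, map_zero, zero_apply,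
      add_zero] using hderiv.self_of_nhds
  · refine HasFDerivAt.congr_of_eventuallyEq ?_ (hderiv.mono fun y hy => hy.fderiv)
    refine ((hφ.hasFDerivAt.smul hf.hasFDerivAt_fderiv).add
      ((ContinuousLinearMap.smulRightL ℝ E F).hasFDerivAt_of_bilinear hφ.hasFDerivAt_fderiv
        hf.hasFDerivAt)).congr_fderiv ?_
    ext a b
    simp [ContinuousLinearMap.precompR, ContinuousLinearMap.precompL]

end HasCriticalHessianAt

/-! ### Curvature at a critical point of the metric -/

section Curvature

variable {E : Type*} [NormedAddCommGroup E] [NormedSpace ℝ E]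

set_option maxSynthPendingDepth 3 in
/-- The map that sends the derivative of a metric `G` at `x` to `christoffelFirst G x a b`. -/
noncomputable def christoffelFirstL (a b : E) : (E →L[ℝ] ContBilinMap E ℝ) →L[ℝ] E →L[ℝ] ℝ :=
  (1 / 2 : ℝ) •
    ((ContinuousLinearMap.apply ℝ (E →L[ℝ] ℝ) b).comp
        (ContinuousLinearMap.apply ℝ (ContBilinMap E ℝ) a)
      + (ContinuousLinearMap.apply ℝ (E →L[ℝ] ℝ) a).comp
        (ContinuousLinearMap.apply ℝ (ContBilinMap E ℝ) b)
      - (ContinuousLinearMap.apply ℝ (E →L[ℝ] ℝ) b).comp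
          ((ContinuousLinearMap.flipₗᵢ ℝ E E ℝ).toContinuousLinearEquiv.toContinuousLinearMap.comp
            ((ContinuousLinearMap.apply ℝ (ContBilinMap E ℝ) a).comp
              (ContinuousLinearMap.flipₗᵢ ℝ E E
                (E →L[ℝ] ℝ)).toContinuousLinearEquiv.toContinuousLinearMap)))

theorem christoffelFirstL_fderiv (G : E → ContBilinMap E ℝ) (x a b : E) :
    christoffelFirstL a b (fderiv ℝ G x) = christoffelFirst G x a b := rfl

theorem christoffelFirstL_apply (T : E →L[ℝ] ContBilinMap E ℝ) (a b c : E) :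
    christoffelFirstL a b T c = 1 / 2 * (T a b c + T b a c - T c a b) := rfl

namespace HasCriticalHessianAt

variable {G : E → ContBilinMap E ℝ} {x : E} {H : ContBilinMap E (ContBilinMap E ℝ)}

theorem christoffelFirst_eq_zero (h : HasCriticalHessianAt G H x) (a b : E) :
    christoffelFirst G x a b = 0 := by
  rw [← christoffelFirstL_fderiv, h.hasFDerivAt.fderiv, map_zero]

theorem christoffel_eq_zero (h : HasCriticalHessianAt G H x) (a b : E) :
    christoffel G x a b = 0 := by
  rw [christoffel, h.christoffelFirst_eq_zero, map_zero]

variable [CompleteSpace E]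

set_option maxSynthPendingDepth 3 in
theorem hasFDerivAt_christoffel (h : HasCriticalHessianAt G H x) (hx : (G x).IsInvertible)
    (a b : E) :
    HasFDerivAt (fun y => christoffel G y a b)
      ((G x).inverse.comp ((christoffelFirstL a b).comp H)) x := by
  obtain ⟨e, he⟩ := hx
  have hinv : DifferentiableAt ℝ (fun y => (G y).inverse) x := by
    have := (contDiffAt_map_inverse (𝕜 := ℝ) (n := 1) e).differentiableAt (by simp)
    rw [he] at this
    exact this.comp x h.hasFDerivAt.differentiableAt
  have hfirst : HasFDerivAt (fun y => christoffelFirst G y a b)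
      ((christoffelFirstL a b).comp H) x :=
    (christoffelFirstL a b).hasFDerivAt.comp x h.hasFDerivAt_fderiv
  refine (hinv.hasFDerivAt.clm_apply hfirst).congr_fderiv ?_
  rw [h.christoffelFirst_eq_zero, map_zero, add_zero]

theorem apply_coordCurvature (h : HasCriticalHessianAt G H x) (hx : (G x).IsInvertible)
    (a b c d : E) :
    G x (coordCurvature G x a b c) d
      = 1 / 2 * (H b c a d - H b d a c - H a c b d + H a d b c) := by
  have hinv : ∀ l, G x ((G x).inverse l) = l := fun l => by
    obtain ⟨e, he⟩ := hx
    rw [← he, ContinuousLinearMap.inverse_equiv]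
    exact e.apply_symm_apply l
  rw [coordCurvature, h.christoffel_eq_zero a, h.christoffel_eq_zero b c, h.christoffel_eq_zero a,
    h.christoffel_eq_zero b, (h.hasFDerivAt_christoffel hx a c).fderiv,
    (h.hasFDerivAt_christoffel hx b c).fderiv, add_zero, sub_zero, map_sub]
  simp only [ContinuousLinearMap.comp_apply, hinv, sub_apply, christoffelFirstL_apply,
    h.symmetric a b]
  ring

end HasCriticalHessianAt

theorem isInvertible_of_anisotropic [FiniteDimensional ℝ E] (B : ContBilinMap E ℝ)
    (hB : ∀ v, B v v = 0 → v = 0) : B.IsInvertible := by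
  have hinj : Function.Injective (B : E →ₗ[ℝ] E →L[ℝ] ℝ) := by
    refine (injective_iff_map_eq_zero _).2 fun v hv => hB v ?_
    exact DFunLike.congr_fun hv v
  have hfin : FiniteDimensional ℝ (E →L[ℝ] ℝ) :=
    (LinearMap.toContinuousLinearMap (𝕜 := ℝ) (E := E) (F' := ℝ)).finiteDimensional
  have hdim : Module.finrank ℝ E = Module.finrank ℝ (E →L[ℝ] ℝ) :=
    Subspace.dual_finrank_eq.symm.trans
      (LinearMap.toContinuousLinearMap (𝕜 := ℝ) (E := E) (F' := ℝ)).finrank_eq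
  exact ⟨((B : E →ₗ[ℝ] E →L[ℝ] ℝ).linearEquivOfInjective hinj hdim).toContinuousLinearEquiv, rfl⟩

variable {M : Type*} [TopologicalSpace M] [ChartedSpace E M]

theorem hasMFDerivAt_chartAt_symm (p : M) {x : E} (hx : x ∈ (chartAt E p).target)
    (h : chartAt E ((chartAt E p).symm x) = chartAt E p) :
    HasMFDerivAt 𝓘(ℝ, E) 𝓘(ℝ, E) (chartAt E p).symm x (ContinuousLinearMap.id ℝ E) := by
  refine ⟨(chartAt E p).continuousAt_symm hx, ?_⟩
  refine ((hasFDerivAt_id (𝕜 := ℝ) x).congr_of_eventuallyEq ?_).hasFDerivWithinAt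
  filter_upwards [(chartAt E p).open_target.mem_nhds hx] with y hy
  simp only [writtenInExtChartAt, Function.comp_apply, extChartAt_model_space_eq_id,
    PartialEquiv.refl_symm, PartialEquiv.refl_coe, id_eq, extChartAt_coe, h,
    modelWithCornersSelf_coe]
  exact (chartAt E p).right_inv hy

theorem chartMetric_eq
    (g : ∀ q : M, TangentSpace 𝓘(ℝ, E) q →L[ℝ] TangentSpace 𝓘(ℝ, E) q →L[ℝ] ℝ)
    (p : M) {x : E} (hx : x ∈ (chartAt E p).target)
    (h : chartAt E ((chartAt E p).symm x) = chartAt E p) :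
    chartMetric g p x = (g ((chartAt E p).symm x) : ContBilinMap E ℝ) := by
  simp only [chartMetric, (hasMFDerivAt_chartAt_symm p hx h).mfderiv]
  rfl

theorem chartMetric_chartAt_self
    (g : ∀ q : M, TangentSpace 𝓘(ℝ, E) q →L[ℝ] TangentSpace 𝓘(ℝ, E) q →L[ℝ] ℝ) (p : M) :
    chartMetric g p (chartAt E p p) = (g p : ContBilinMap E ℝ) := by
  have hp := (chartAt E p).left_inv (mem_chart_source E p)
  rw [chartMetric_eq g p (mem_chart_target E p) (by rw [hp]), hp]

theorem riemannCurvature_eq_of_chartMetric [CompleteSpace E]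
    {g : ∀ q : M, TangentSpace 𝓘(ℝ, E) q →L[ℝ] TangentSpace 𝓘(ℝ, E) q →L[ℝ] ℝ} {p : M}
    {H : ContBilinMap E (ContBilinMap E ℝ)}
    (h : HasCriticalHessianAt (chartMetric g p) H (chartAt E p p))
    (hp : ContinuousLinearMap.IsInvertible (g p : ContBilinMap E ℝ)) (a b c d : E) :
    riemannCurvature g p a b c d = 1 / 2 * (H b c a d - H b d a c - H a c b d + H a d b c) := by
  rw [← chartMetric_chartAt_self g p] at hp
  rw [← h.apply_coordCurvature hp, chartMetric_chartAt_self]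
  rfl

end Curvature

section ConformalQuadratic

variable {E F : Type*} [NormedAddCommGroup E] [NormedSpace ℝ E] [NormedAddCommGroup F]
  [NormedSpace ℝ F]

/-- The map `y ↦ (1 + ε N(y))⁻² (P + ε Q(y))` for the quadratic maps `N(y) = N y y` and
`Q(y) = Q y y`, which is the common shape of the metrics of `𝕆P²` (`ε = 1`) and `𝕆H²` (`ε = -1`) in
affine coordinates. -/
noncomputable def conformalQuadratic (N : ContBilinMap E ℝ) (Q : ContBilinMap E F) (P : F) (ε : ℝ)
    (y : E) : F :=
  ((1 + ε * N y y) ^ 2)⁻¹ • (P + ε • Q y y)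

variable (N : ContBilinMap E ℝ) (Q : ContBilinMap E F) (P : F) {ε : ℝ}

theorem conformalQuadratic_zero : conformalQuadratic N Q P ε 0 = P := by
  simp [conformalQuadratic]

theorem contDiffAt_conformalQuadratic {n : WithTop ℕ∞} {y : E} (hy : 1 + ε * N y y ≠ 0) :
    ContDiffAt ℝ n (conformalQuadratic N Q P ε) y := by
  have hN : ContDiff ℝ n fun y => N y y :=
    N.isBoundedBilinearMap.contDiff.comp (contDiff_id.prodMk contDiff_id)
  have hQ : ContDiff ℝ n fun y => Q y y :=
    Q.isBoundedBilinearMap.contDiff.comp (contDiff_id.prodMk contDiff_id)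
  have hden : ContDiff ℝ n fun y => (1 + ε * N y y) ^ 2 :=
    (contDiff_const.add (contDiff_const.mul hN)).pow 2
  exact (hden.contDiffAt.inv (pow_ne_zero 2 hy)).smul
    (contDiff_const.add (contDiff_const.smul hQ)).contDiffAt

theorem exists_hasCriticalHessianAt_conformalQuadratic (ε : ℝ) :
    ∃ H : ContBilinMap E F, HasCriticalHessianAt (conformalQuadratic N Q P ε) H 0 ∧
      ∀ a b, H a b = ε • (Q a b + Q b a - (2 * (N a b + N b a)) • P) := by
  have hφ : HasDerivAt (fun t : ℝ => ((1 + ε * t) ^ 2)⁻¹) (-2 * ε) (N 0 0) := by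
    have hone : HasDerivAt (fun t : ℝ => 1 + ε * t) ε (N 0 0) := by
      simpa only [mul_one] using ((hasDerivAt_id' (N 0 0)).const_mul ε).const_add 1
    simpa using (hone.fun_pow 2).fun_inv (by simp)
  have hφ' : ContDiffAt ℝ 2 (fun t : ℝ => ((1 + ε * t) ^ 2)⁻¹) (N 0 0) :=
    ContDiffAt.inv (by fun_prop) (by simp)
  refine ⟨_, ((HasCriticalHessianAt.of_bilinear N).comp_left hφ').smul
    (((HasCriticalHessianAt.of_bilinear Q).const_smul ε).const_add P), fun a b => ?_⟩
  rw [hφ.deriv]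
  simp only [map_zero, mul_zero, add_zero, one_pow, inv_one, smul_add, one_smul,
    smul_zero, neg_mul, neg_smul, ContinuousLinearMap.comp_add, ContinuousLinearMap.comp_neg,
    ContinuousLinearMap.comp_smulₛₗ, Real.ringHom_apply, add_apply, smul_apply, neg_apply,
    ContinuousLinearMap.comp_apply, ContinuousLinearMap.flip_apply,
    ContinuousLinearMap.smulRightL_apply_apply, ContinuousLinearMap.smulRight_apply]
  module

end ConformalQuadratic

/-! ### Boosts -/

/-- The octonionic form of the complex kernel `|1 - x₁ȳ₁ - x₂ȳ₂|²`. The cross term of that square is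
regrouped as `⟨x₁x̄₂, y₁ȳ₂⟩`, which makes a difference since `𝕆` is not associative. -/
noncomputable def ballKernel (x y : OctPlane) : ℝ :=
  moebiusDen x.1 y.1 + moebiusDen x.2 y.2 - 1 + 2 * inner ℝ (x.1 * star x.2) (y.1 * star y.2)

theorem ballKernel_swap (x y : OctPlane) : ballKernel x.swap y.swap = ballKernel x y := by
  have h : (inner ℝ (x.2 * star x.1) (y.2 * star y.1) : ℝ)
      = inner ℝ (x.1 * star x.2) (y.1 * star y.2) := by
    rw [← Octonion.inner_star_star]
    simp only [Octonion.star_mul', Octonion.star_star']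
  simp only [ballKernel, Prod.fst_swap, Prod.snd_swap, h]
  ring

/-- For `|a| < 1`, the isometric involution of `𝕆H²` that exchanges `(a, 0)` and the origin. Over
the complex numbers it is `(u, v) ↦ ((a - u) / (1 - ā u), √(1 - |a|²) v / (1 - ā u))`. -/
noncomputable def boost (a : Octonion) (x : OctPlane) : OctPlane :=
  (moebius a x.1, (√(1 - ‖a‖ ^ 2) * (moebiusDen a x.1)⁻¹) • (x.2 - x.2 * star x.1 * a))

variable {a : Octonion}

@[simp] theorem boost_self_zero (a : Octonion) : boost a (a, 0) = 0 := by
  simp [boost]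

theorem star_boost_snd (a : Octonion) (x : OctPlane) :
    star (boost a x).2 = (√(1 - ‖a‖ ^ 2) * (moebiusDen a x.1)⁻¹) •
      (star x.2 - star a * (x.1 * star x.2)) := by
  simp only [boost, Octonion.star_smul', Octonion.star_sub', Octonion.star_mul',
    Octonion.star_star']

theorem boost_fst_mul_star_snd {x : OctPlane} (hx : moebiusDen a x.1 ≠ 0) :
    (boost a x).1 * star (boost a x).2
      = (√(1 - ‖a‖ ^ 2) * (moebiusDen a x.1)⁻¹) • ((a - x.1) * star x.2) := by
  have hexp : ((1 + ‖x.1‖ ^ 2 - 2 * inner ℝ a x.1) • a - (1 - ‖a‖ ^ 2) • x.1)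
      * (star x.2 - star a * (x.1 * star x.2)) = moebiusDen a x.1 • ((a - x.1) * star x.2) := by
    have hpol := Octonion.mul_star_mul_add_mul_star_mul a x.1 (x.1 * star x.2)
    rw [Octonion.star_mul_mul, mul_smul_comm] at hpol
    simp only [sub_mul, mul_sub, smul_mul_assoc, Octonion.self_mul_star_mul, moebiusDen]
    linear_combination (norm := module) (1 - ‖a‖ ^ 2) • hpol
  rw [star_boost_snd, boost, moebius, smul_mul_assoc, mul_smul_comm, hexp, smul_comm,
    inv_smul_smul₀ hx]

theorem inner_boost_snd (ha : ‖a‖ ^ 2 < 1) (x y : OctPlane) :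
    inner ℝ (boost a x).2 (boost a y).2
      = (1 - ‖a‖ ^ 2) * (inner ℝ x.2 y.2 - inner ℝ (a * star x.2) (y.1 * star y.2)
          - inner ℝ (x.1 * star x.2) (a * star y.2)
          + ‖a‖ ^ 2 * inner ℝ (x.1 * star x.2) (y.1 * star y.2))
        / (moebiusDen a x.1 * moebiusDen a y.1) := by
  have hκ := Real.mul_self_sqrt (sub_pos.2 ha).le
  rw [← Octonion.inner_star_star, star_boost_snd, star_boost_snd]
  simp only [real_inner_smul_left, real_inner_smul_right, inner_sub_left, inner_sub_right,
    Octonion.inner_mul_mul_left, Octonion.inner_star_star, Octonion.norm_star']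
  have h₁ : (inner ℝ (star x.2) (star a * (y.1 * star y.2)) : ℝ)
      = inner ℝ (a * star x.2) (y.1 * star y.2) := (Octonion.inner_mul_left _ _ _).symm
  have h₂ : (inner ℝ (star a * (x.1 * star x.2)) (star y.2) : ℝ)
      = inner ℝ (x.1 * star x.2) (a * star y.2) := by
    rw [Octonion.inner_mul_left, Octonion.star_star']
  rw [h₁, h₂, div_eq_mul_inv, mul_inv]
  linear_combination ((moebiusDen a x.1)⁻¹ * (moebiusDen a y.1)⁻¹ * (inner ℝ x.2 y.2
    - inner ℝ (a * star x.2) (y.1 * star y.2) - inner ℝ (x.1 * star x.2) (a * star y.2)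
    + ‖a‖ ^ 2 * inner ℝ (x.1 * star x.2) (y.1 * star y.2))) * hκ

theorem norm_boost_snd_sq (ha : ‖a‖ ^ 2 < 1) {x : OctPlane} (hx : moebiusDen a x.1 ≠ 0) :
    ‖(boost a x).2‖ ^ 2 = (1 - ‖a‖ ^ 2) * ‖x.2‖ ^ 2 / moebiusDen a x.1 := by
  rw [← real_inner_self_eq_norm_sq, inner_boost_snd ha]
  simp only [Octonion.inner_mul_mul_right, real_inner_self_eq_norm_sq, Octonion.norm_mul_sq,
    Octonion.norm_star', real_inner_comm a x.1]
  field_simp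
  rw [moebiusDen]
  ring

theorem one_sub_norm_boost_sq (ha : ‖a‖ ^ 2 < 1) {x : OctPlane} (hx : moebiusDen a x.1 ≠ 0) :
    1 - ‖(boost a x).1‖ ^ 2 - ‖(boost a x).2‖ ^ 2
      = (1 - ‖a‖ ^ 2) * (1 - ‖x.1‖ ^ 2 - ‖x.2‖ ^ 2) / moebiusDen a x.1 := by
  rw [norm_boost_snd_sq ha hx, show (boost a x).1 = moebius a x.1 from rfl,
    one_sub_norm_moebius_sq hx]
  ring

theorem ballKernel_boost (ha : ‖a‖ ^ 2 < 1) {x y : OctPlane} (hx : moebiusDen a x.1 ≠ 0)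
    (hy : moebiusDen a y.1 ≠ 0) :
    ballKernel (boost a x) (boost a y)
      = (1 - ‖a‖ ^ 2) ^ 2 * ballKernel x y / (moebiusDen a x.1 * moebiusDen a y.1) := by
  have hκ := Real.mul_self_sqrt (sub_pos.2 ha).le
  have hcross : inner ℝ ((boost a x).1 * star (boost a x).2) ((boost a y).1 * star (boost a y).2)
      = (1 - ‖a‖ ^ 2) * (‖a‖ ^ 2 * inner ℝ x.2 y.2 - inner ℝ (a * star x.2) (y.1 * star y.2)
          - inner ℝ (x.1 * star x.2) (a * star y.2)
          + inner ℝ (x.1 * star x.2) (y.1 * star y.2))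
        / (moebiusDen a x.1 * moebiusDen a y.1) := by
    rw [boost_fst_mul_star_snd hx, boost_fst_mul_star_snd hy, real_inner_smul_left,
      real_inner_smul_right, sub_mul, sub_mul, inner_sub_left, inner_sub_right, inner_sub_right,
      Octonion.inner_mul_mul_left, Octonion.inner_star_star, div_eq_mul_inv, mul_inv]
    linear_combination ((moebiusDen a x.1)⁻¹ * (moebiusDen a y.1)⁻¹ * (‖a‖ ^ 2 * inner ℝ x.2 y.2
      - inner ℝ (a * star x.2) (y.1 * star y.2) - inner ℝ (x.1 * star x.2) (a * star y.2)
      + inner ℝ (x.1 * star x.2) (y.1 * star y.2))) * hκ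
  have hfst : moebiusDen (boost a x).1 (boost a y).1
      = (1 - ‖a‖ ^ 2) ^ 2 * moebiusDen x.1 y.1 / (moebiusDen a x.1 * moebiusDen a y.1) :=
    moebiusDen_moebius_moebius hx hy
  have hsnd : moebiusDen (boost a x).2 (boost a y).2 = 1
      - 2 * inner ℝ (boost a x).2 (boost a y).2 + ‖(boost a x).2‖ ^ 2 * ‖(boost a y).2‖ ^ 2 := rfl
  rw [ballKernel, hcross, hfst, hsnd, inner_boost_snd ha, norm_boost_snd_sq ha hx,
    norm_boost_snd_sq ha hy, ballKernel]
  field_simp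
  simp only [moebiusDen]
  ring

theorem boost_boost (ha : ‖a‖ ^ 2 < 1) {x : OctPlane} (hx : ‖x.1‖ ^ 2 < 1) :
    boost a (boost a x) = x := by
  have hδ := (moebiusDen_pos ha hx).ne'
  have hα : 1 - ‖a‖ ^ 2 ≠ 0 := (sub_pos.2 ha).ne'
  have hκ := Real.mul_self_sqrt (sub_pos.2 ha).le
  have hcross : (boost a x).2 * star (boost a x).1 * a
      = (√(1 - ‖a‖ ^ 2) * (moebiusDen a x.1)⁻¹) • (‖a‖ ^ 2 • x.2 - x.2 * star x.1 * a) := by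
    have h := congrArg star (boost_fst_mul_star_snd hδ)
    rw [Octonion.star_smul', Octonion.star_mul', Octonion.star_star', Octonion.star_mul',
      Octonion.star_star'] at h
    rw [h, Octonion.star_sub', smul_mul_assoc, mul_sub, sub_mul, Octonion.mul_star_mul_self]
  refine Prod.ext (moebius_moebius ha hx) ?_
  change (√(1 - ‖a‖ ^ 2) * (moebiusDen a (moebius a x.1))⁻¹) •
    ((boost a x).2 - (boost a x).2 * star (boost a x).1 * a) = x.2
  rw [hcross, moebiusDen_moebius hδ, boost]
  match_scalars
  · field_simp
    linear_combination hκ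
  · ring

/-! ### The hyperbolic metric and its isometries -/

theorem planeForm_apply (α β : ℝ) (q : Octonion) (X Y : OctPlane) :
    planeForm α β q X Y = α * inner ℝ X.1 Y.1 + β * inner ℝ X.2 Y.2
      + (inner ℝ q (Y.1 * star X.2) + inner ℝ q (X.1 * star Y.2)) := by
  simp only [planeForm, LinearMap.toContinuousBilinearMap_apply, LinearMap.mk₂_apply,
    Octonion.re_mul_eq_inner, Octonion.star_mul', Octonion.star_star']

theorem planeForm_comm (α β : ℝ) (q : Octonion) (X Y : OctPlane) :
    planeForm α β q X Y = planeForm α β q Y X := by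
  simp only [planeForm_apply, real_inner_comm X.1, real_inner_comm X.2]
  ring

theorem hypForm_comm (x X Y : OctPlane) : hypForm x X Y = hypForm x Y X := by
  simp only [hypForm, smul_apply, planeForm_comm _ _ _ X Y]

theorem hypForm_apply_self (x X : OctPlane) :
    hypForm x X X = (‖X.1‖ ^ 2 * (1 - ‖x.2‖ ^ 2) + ‖X.2‖ ^ 2 * (1 - ‖x.1‖ ^ 2)
      + 2 * inner ℝ (x.1 * star x.2) (X.1 * star X.2)) / (1 - ‖x.1‖ ^ 2 - ‖x.2‖ ^ 2) ^ 2 := by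
  have h := hypForm_self x.1 x.2 X.1 X.2
  rwa [Octonion.re_mul_eq_inner, Octonion.star_mul', Octonion.star_star'] at h

theorem norm_sq_le_hypForm {x : OctPlane} (hx : x ∈ OH2) (X : OctPlane) :
    ‖X.1‖ ^ 2 + ‖X.2‖ ^ 2 ≤ hypForm x X X := by
  have hx : ‖x.1‖ ^ 2 + ‖x.2‖ ^ 2 < 1 := hx
  have hd : 0 < 1 - ‖x.1‖ ^ 2 - ‖x.2‖ ^ 2 := by linarith
  have hmul : ∀ a b : Octonion, ‖a * star b‖ = ‖a‖ * ‖b‖ := fun a b => by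
    rw [← sq_eq_sq₀ (norm_nonneg _) (by positivity), Octonion.norm_mul_sq, Octonion.norm_star',
      mul_pow]
  have hcross := neg_le_of_abs_le (abs_real_inner_le_norm (x.1 * star x.2) (X.1 * star X.2))
  rw [hmul, hmul] at hcross
  have hdefect : (1 - ‖x.1‖ ^ 2 - ‖x.2‖ ^ 2) ^ 2 * (‖X.1‖ ^ 2 + ‖X.2‖ ^ 2)
      ≤ (1 - ‖x.1‖ ^ 2 - ‖x.2‖ ^ 2) * (‖X.1‖ ^ 2 + ‖X.2‖ ^ 2) := by
    gcongr
    nlinarith [sq_nonneg ‖x.1‖, sq_nonneg ‖x.2‖]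
  rw [hypForm_apply_self, le_div_iff₀ (by positivity)]
  nlinarith [sq_nonneg (‖x.1‖ * ‖X.1‖ - ‖x.2‖ * ‖X.2‖)]

theorem hypForm_pos {x : OctPlane} (hx : x ∈ OH2) {X : OctPlane} (hX : X ≠ 0) :
    0 < hypForm x X X := by
  refine lt_of_lt_of_le ?_ (norm_sq_le_hypForm hx X)
  by_cases h0 : X.1 = 0
  · have : X.2 ≠ 0 := fun h => hX (Prod.ext h0 h)
    positivity
  · positivity

/-- The kernel whose value at `(x, y)` is the squared hyperbolic cosine of the distance from `x` to
`y` in `𝕆H²`. Only its invariance and its second-order behaviour on the diagonal are used. -/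
noncomputable def coshSqDist (x y : OctPlane) : ℝ :=
  ballKernel x y / ((1 - ‖x.1‖ ^ 2 - ‖x.2‖ ^ 2) * (1 - ‖y.1‖ ^ 2 - ‖y.2‖ ^ 2))

theorem tendsto_add_smul {E : Type*} [NormedAddCommGroup E] [NormedSpace ℝ E] (x v : E) :
    Filter.Tendsto (fun t : ℝ => x + t • v) (𝓝[≠] 0) (𝓝 x) :=
  (Continuous.tendsto' (by fun_prop) 0 x (by simp)).mono_left nhdsWithin_le_nhds

namespace OH2

open Filter

theorem one_sub_norm_sq_pos {x : OctPlane} (hx : x ∈ OH2) : 0 < 1 - ‖x.1‖ ^ 2 - ‖x.2‖ ^ 2 := by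
  have : ‖x.1‖ ^ 2 + ‖x.2‖ ^ 2 < 1 := hx
  linarith

theorem coshSqDist_sub_one {x y : OctPlane} (hx : x ∈ OH2) (hy : y ∈ OH2) :
    coshSqDist x y - 1 = (1 - ‖x.1‖ ^ 2 - ‖x.2‖ ^ 2) / (1 - ‖y.1‖ ^ 2 - ‖y.2‖ ^ 2)
      * hypForm x (y - x) (y - x) := by
  have hx := (one_sub_norm_sq_pos hx).ne'
  have hy := (one_sub_norm_sq_pos hy).ne'
  rw [coshSqDist, hypForm_apply_self]
  field_simp
  simp only [ballKernel, moebiusDen, Prod.fst_sub, Prod.snd_sub, norm_sub_sq_real,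
    Octonion.star_sub', mul_sub, sub_mul, inner_sub_right, Octonion.inner_mul_mul_right,
    Octonion.inner_mul_mul_left, Octonion.inner_star_star, Octonion.norm_star',
    real_inner_self_eq_norm_sq, real_inner_comm x.1 y.1, real_inner_comm x.2 y.2]
  rw [Octonion.norm_mul_sq, Octonion.norm_star']
  ring

theorem tendsto_coshSqDist {F : OctPlane → OctPlane} {D : OctPlane →L[ℝ] OctPlane}
    {x : OctPlane} (hF : HasFDerivAt F D x) (hx : F x ∈ OH2) (X : OctPlane) :
    Tendsto (fun t : ℝ => (t ^ 2)⁻¹ * (coshSqDist (F x) (F (x + t • X)) - 1)) (𝓝[≠] 0)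
      (𝓝 (hypForm (F x) (D X) (D X))) := by
  have hslope : Tendsto (fun t : ℝ => t⁻¹ • (F (x + t • X) - F x)) (𝓝[≠] 0) (𝓝 (D X)) :=
    hasLineDerivAt_iff_tendsto_slope_zero.1 (hF.hasLineDerivAt X)
  have hcurve : Tendsto (fun t : ℝ => F (x + t • X)) (𝓝[≠] 0) (𝓝 (F x)) :=
    hF.continuousAt.tendsto.comp (tendsto_add_smul x X)
  have hratio : Tendsto (fun t : ℝ => (1 - ‖(F x).1‖ ^ 2 - ‖(F x).2‖ ^ 2)
      / (1 - ‖(F (x + t • X)).1‖ ^ 2 - ‖(F (x + t • X)).2‖ ^ 2)) (𝓝[≠] 0) (𝓝 1) := by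
    have hdefect : Continuous fun y : OctPlane => 1 - ‖y.1‖ ^ 2 - ‖y.2‖ ^ 2 := by fun_prop
    have hpos := (one_sub_norm_sq_pos hx).ne'
    have hdiv := (tendsto_const_nhds (x := 1 - ‖(F x).1‖ ^ 2 - ‖(F x).2‖ ^ 2)).div
      ((hdefect.tendsto (F x)).comp hcurve) hpos
    rwa [div_self hpos] at hdiv
  have hform : Continuous fun Z : OctPlane => hypForm (F x) Z Z := by fun_prop
  rw [← one_mul (hypForm (F x) (D X) (D X))]
  refine (hratio.mul ((hform.tendsto (D X)).comp hslope)).congr' ?_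
  filter_upwards [hcurve.eventually_mem (OH2.isOpen.mem_nhds hx)] with t ht
  rw [coshSqDist_sub_one hx ht]
  simp only [Function.comp_apply, map_smul, smul_apply, smul_eq_mul]
  ring

theorem hypForm_map_self {F : OctPlane → OctPlane} (hF : ∀ x ∈ OH2, F x ∈ OH2)
    (hdist : ∀ x ∈ OH2, ∀ y ∈ OH2, coshSqDist (F x) (F y) = coshSqDist x y)
    {D : OctPlane →L[ℝ] OctPlane} {x : OctPlane} (hx : x ∈ OH2) (hD : HasFDerivAt F D x)
    (X : OctPlane) : hypForm (F x) (D X) (D X) = hypForm x X X := by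
  refine tendsto_nhds_unique (tendsto_coshSqDist hD (hF x hx) X)
    ((tendsto_coshSqDist (hasFDerivAt_id (𝕜 := ℝ) x) hx X).congr' ?_)
  filter_upwards [(tendsto_add_smul x X).eventually_mem (OH2.isOpen.mem_nhds hx)] with t ht
  simp only [id_eq, hdist x hx _ ht]

theorem hypForm_map {F : OctPlane → OctPlane} (hF : ∀ x ∈ OH2, F x ∈ OH2)
    (hdist : ∀ x ∈ OH2, ∀ y ∈ OH2, coshSqDist (F x) (F y) = coshSqDist x y)
    {D : OctPlane →L[ℝ] OctPlane} {x : OctPlane} (hx : x ∈ OH2) (hD : HasFDerivAt F D x)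
    (X Y : OctPlane) : hypForm (F x) (D X) (D Y) = hypForm x X Y := by
  have hself := hypForm_map_self hF hdist hx hD
  have hsum := hself (X + Y)
  simp only [map_add, add_apply, hself, hypForm_comm _ Y X, hypForm_comm _ (D Y) (D X)] at hsum
  linarith

end OH2

theorem contDiffAt_boost {a : Octonion} {x : OctPlane} (hx : moebiusDen a x.1 ≠ 0) :
    ContDiffAt ℝ ∞ (boost a) x := by
  have hstar : ContDiff ℝ ∞ fun y : OctPlane => (y.2, star y.1) :=
    contDiff_snd.prodMk (Octonion.contDiff_star.comp contDiff_fst)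
  have hmul : ContDiff ℝ ∞ fun y : OctPlane => (y.2 * star y.1, a) :=
    (Octonion.contDiff_mul.comp hstar).prodMk contDiff_const
  have hscale : ContDiffAt ℝ ∞ (fun y : OctPlane => (moebiusDen a y.1)⁻¹) x :=
    (contDiffAt_moebiusDen_inv hx).comp x contDiffAt_fst
  exact ((contDiffAt_moebius hx).comp x contDiffAt_fst).prodMk
    ((contDiffAt_const.mul hscale).smul
      (contDiffAt_snd.sub (Octonion.contDiff_mul.comp hmul).contDiffAt))

namespace OH2

theorem norm_fst_sq_lt_one {x : OctPlane} (hx : x ∈ OH2) : ‖x.1‖ ^ 2 < 1 := by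
  linarith [one_sub_norm_sq_pos hx, sq_nonneg ‖x.2‖]

theorem swap_mem {x : OctPlane} (hx : x ∈ OH2) : x.swap ∈ OH2 := by
  have hx : ‖x.1‖ ^ 2 + ‖x.2‖ ^ 2 < 1 := hx
  exact (add_comm _ _).trans_lt hx

theorem coshSqDist_swap (x y : OctPlane) : coshSqDist x.swap y.swap = coshSqDist x y := by
  simp only [coshSqDist, ballKernel_swap, Prod.fst_swap, Prod.snd_swap, sub_right_comm]

variable {a : Octonion}

theorem boost_mem (ha : ‖a‖ ^ 2 < 1) {x : OctPlane} (hx : x ∈ OH2) : boost a x ∈ OH2 := by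
  have hδ := moebiusDen_pos ha (norm_fst_sq_lt_one hx)
  have hdefect := one_sub_norm_boost_sq ha hδ.ne'
  have hpos := div_pos (mul_pos (sub_pos.2 ha) (one_sub_norm_sq_pos hx)) hδ
  change ‖(boost a x).1‖ ^ 2 + ‖(boost a x).2‖ ^ 2 < 1
  linarith

theorem coshSqDist_boost (ha : ‖a‖ ^ 2 < 1) {x y : OctPlane} (hx : x ∈ OH2) (hy : y ∈ OH2) :
    coshSqDist (boost a x) (boost a y) = coshSqDist x y := by
  have hδx := (moebiusDen_pos ha (norm_fst_sq_lt_one hx)).ne'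
  have hδy := (moebiusDen_pos ha (norm_fst_sq_lt_one hy)).ne'
  have hα : 1 - ‖a‖ ^ 2 ≠ 0 := (sub_pos.2 ha).ne'
  rw [coshSqDist, ballKernel_boost ha hδx hδy, one_sub_norm_boost_sq ha hδx,
    one_sub_norm_boost_sq ha hδy, coshSqDist]
  field_simp

theorem exists_isometry_of_involution {F : OctPlane → OctPlane} (hF : ∀ x ∈ OH2, F x ∈ OH2)
    (hinv : ∀ x ∈ OH2, F (F x) = x) (hsmooth : ∀ x ∈ OH2, ContDiffAt ℝ ∞ F x)
    (hdist : ∀ x ∈ OH2, ∀ y ∈ OH2, coshSqDist (F x) (F y) = coshSqDist x y) :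
    ∃ f : OH2 ≃ₘ^∞⟮𝓘(ℝ, OctPlane), 𝓘(ℝ, OctPlane)⟯ OH2,
      IsMetricIsometry OH2.metric f ∧ ∀ p : OH2, (f p : OctPlane) = F p := by
  let f : OH2 → OH2 := fun p => ⟨F p, hF p p.2⟩
  have hf : ContMDiff 𝓘(ℝ, OctPlane) 𝓘(ℝ, OctPlane) ∞ f :=
    contMDiff_opens_of_coe_eq (fun _ => rfl) hsmooth
  have hff : Function.Involutive f := fun p => Subtype.ext (hinv p p.2)
  refine ⟨⟨hff.toPerm, hf, hf⟩, fun q v w => ?_, fun p => rfl⟩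
  let D : OctPlane →L[ℝ] OctPlane := fderiv ℝ F (q : OctPlane)
  have hD : HasFDerivAt F D q := ((hsmooth q q.2).differentiableAt (by simp)).hasFDerivAt
  have hfD : HasMFDerivAt 𝓘(ℝ, OctPlane) 𝓘(ℝ, OctPlane) f q D :=
    hasMFDerivAt_opens_of_coe_eq (fun _ => rfl) hD
  change hypForm (F q) (mfderiv _ _ f q v) (mfderiv _ _ f q w) = hypForm q v w
  rw [hfD.mfderiv]
  exact hypForm_map hF hdist q.2 hD v w

theorem exists_isometry_swap :
    ∃ f : OH2 ≃ₘ^∞⟮𝓘(ℝ, OctPlane), 𝓘(ℝ, OctPlane)⟯ OH2,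
      IsMetricIsometry OH2.metric f ∧ ∀ p : OH2, (f p : OctPlane) = (p : OctPlane).swap :=
  exists_isometry_of_involution (fun _ hx => swap_mem hx) (fun x _ => x.swap_swap)
    (fun _ _ => contDiffAt_snd.prodMk contDiffAt_fst) fun x _ y _ => coshSqDist_swap x y

theorem exists_isometry_boost (ha : ‖a‖ ^ 2 < 1) :
    ∃ f : OH2 ≃ₘ^∞⟮𝓘(ℝ, OctPlane), 𝓘(ℝ, OctPlane)⟯ OH2,
      IsMetricIsometry OH2.metric f ∧ ∀ p : OH2, (f p : OctPlane) = boost a p :=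
  exists_isometry_of_involution (fun _ hx => boost_mem ha hx)
    (fun _ hx => boost_boost ha (norm_fst_sq_lt_one hx))
    (fun _ hx => contDiffAt_boost (moebiusDen_pos ha (norm_fst_sq_lt_one hx)).ne')
    fun _ hx _ hy => coshSqDist_boost ha hx hy

theorem exists_isometry_map_eq_origin (p : OH2) :
    ∃ f : OH2 ≃ₘ^∞⟮𝓘(ℝ, OctPlane), 𝓘(ℝ, OctPlane)⟯ OH2,
      IsMetricIsometry OH2.metric f ∧ f p = OH2.origin := by
  obtain ⟨k, hk, hk_apply⟩ := exists_isometry_boost (norm_fst_sq_lt_one p.2)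
  obtain ⟨s, hs, hs_apply⟩ := exists_isometry_swap
  obtain ⟨l, hl, hl_apply⟩ := exists_isometry_boost (norm_fst_sq_lt_one (s (k p)).2)
  refine ⟨(k.trans s).trans l, (hk.trans hs).trans hl, Subtype.ext ?_⟩
  have hk_fst : (k p : OctPlane).1 = 0 := by rw [hk_apply]; exact moebius_self _
  have hs_snd : (s (k p) : OctPlane).2 = 0 := by rw [hs_apply, Prod.snd_swap, hk_fst]
  calc (l (s (k p)) : OctPlane)
      = boost (s (k p) : OctPlane).1 ((s (k p) : OctPlane).1, 0) := by rw [hl_apply, ← hs_snd]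
    _ = 0 := boost_self_zero _

theorem isHomogeneousMetric : IsHomogeneousMetric OH2.metric :=
  isHomogeneousMetric_of_forall_exists exists_isometry_map_eq_origin

theorem convex : Convex ℝ (OH2 : Set OctPlane) := by
  have hsq : ConvexOn ℝ Set.univ fun a : Octonion => ‖a‖ ^ 2 :=
    convexOn_univ_norm.pow (fun _ _ => norm_nonneg _) 2
  have hsum : ConvexOn ℝ Set.univ fun x : OctPlane => ‖x.1‖ ^ 2 + ‖x.2‖ ^ 2 :=
    (hsq.comp_linearMap (LinearMap.fst ℝ Octonion Octonion)).add
      (hsq.comp_linearMap (LinearMap.snd ℝ Octonion Octonion))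
  have hball := hsum.convex_lt 1
  simp only [Set.mem_univ, true_and] at hball
  exact hball

theorem simplyConnectedSpace : SimplyConnectedSpace OH2 := by
  have : ContractibleSpace OH2 := convex.contractibleSpace ⟨_, OH2.origin.2⟩
  exact SimplyConnectedSpace.ofContractible OH2

end OH2

/-! ### The curvature of both planes -/

theorem planeForm_add (α α' β β' : ℝ) (q q' : Octonion) :
    planeForm (α + α') (β + β') (q + q') = planeForm α β q + planeForm α' β' q' := by
  refine ContinuousLinearMap.ext fun X => ContinuousLinearMap.ext fun Y => ?_
  rw [add_apply, add_apply]
  simp only [planeForm_apply, inner_add_left]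
  ring

theorem planeForm_smul (r α β : ℝ) (q : Octonion) :
    planeForm (r * α) (r * β) (r • q) = r • planeForm α β q := by
  refine ContinuousLinearMap.ext fun X => ContinuousLinearMap.ext fun Y => ?_
  rw [smul_apply, smul_apply, smul_eq_mul]
  simp only [planeForm_apply, real_inner_smul_left]
  ring

theorem planeForm_one_one_self (x : OctPlane) : planeForm 1 1 0 x x = ‖x.1‖ ^ 2 + ‖x.2‖ ^ 2 := by
  simp only [planeForm_apply, real_inner_self_eq_norm_sq, inner_zero_left, one_mul, add_zero]

theorem isInvertible_planeForm_one_one : (planeForm 1 1 0 : ContBilinMap OctPlane ℝ).IsInvertible :=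
  isInvertible_of_anisotropic _ fun v hv => by
    rw [planeForm_one_one_self, add_eq_zero_iff_of_nonneg (sq_nonneg _) (sq_nonneg _)] at hv
    exact Prod.ext (by simpa using hv.1) (by simpa using hv.2)

/-- The quadratic part of the numerator of the metric of `𝕆P²`, polarized in the base point without
symmetrization. In the metric of `𝕆H²` it occurs with the opposite sign. -/
noncomputable def planeQuad : ContBilinMap OctPlane (ContBilinMap OctPlane ℝ) :=
  (LinearMap.mk₂ ℝ (fun x y : OctPlane =>
      (planeForm (inner ℝ x.2 y.2) (inner ℝ x.1 y.1) (-(x.1 * star y.2)) :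
        ContBilinMap OctPlane ℝ))
    (fun x x' y => by
      simp only [← planeForm_add, Prod.fst_add, Prod.snd_add, inner_add_left, add_mul, neg_add])
    (fun r x y => by
      simp only [← planeForm_smul, Prod.smul_fst, Prod.smul_snd, real_inner_smul_left,
        smul_mul_assoc, smul_neg])
    (fun x y y' => by
      simp only [← planeForm_add, Prod.fst_add, Prod.snd_add, inner_add_right, mul_add, neg_add,
        Octonion.star_add'])
    (fun r x y => by
      simp only [← planeForm_smul, Prod.smul_fst, Prod.smul_snd, real_inner_smul_right,
        mul_smul_comm, smul_neg, Octonion.star_smul'])).toContinuousBilinearMap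

theorem planeQuad_apply (x y : OctPlane) :
    planeQuad x y = planeForm (inner ℝ x.2 y.2) (inner ℝ x.1 y.1) (-(x.1 * star y.2)) := rfl

/-- The family of metrics that contains, in affine coordinates, the metric of `𝕆P²` (`ε = 1`), the
flat metric (`ε = 0`) and the metric of `𝕆H²` (`ε = -1`). -/
noncomputable def affineForm (ε : ℝ) (x : OctPlane) : ContBilinMap OctPlane ℝ :=
  conformalQuadratic (planeForm 1 1 0 : ContBilinMap OctPlane ℝ) planeQuad (planeForm 1 1 0) ε x

theorem affineForm_eq (ε : ℝ) (x : OctPlane) :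
    affineForm ε x = ((1 + ε * (‖x.1‖ ^ 2 + ‖x.2‖ ^ 2)) ^ 2)⁻¹ •
      planeForm (1 + ε * ‖x.2‖ ^ 2) (1 + ε * ‖x.1‖ ^ 2) (-(ε • (x.1 * star x.2))) := by
  rw [affineForm, conformalQuadratic, planeForm_one_one_self, planeQuad_apply, ← planeForm_smul,
    ← planeForm_add, real_inner_self_eq_norm_sq, real_inner_self_eq_norm_sq, zero_add, smul_neg]

theorem affineForm_one : affineForm 1 = projForm := by
  funext x
  rw [affineForm_eq, projForm]
  simp only [one_mul, one_smul, add_assoc]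

theorem affineForm_neg_one : affineForm (-1) = hypForm := by
  funext x
  rw [affineForm_eq, hypForm]
  simp only [neg_mul, one_mul, neg_smul, one_smul, neg_neg, ← sub_eq_add_neg, sub_sub]

theorem affineForm_zero (ε : ℝ) : affineForm ε 0 = planeForm 1 1 0 :=
  conformalQuadratic_zero (E := OctPlane) _ _ _

theorem contDiffAt_hypForm {n : WithTop ℕ∞} {x : OctPlane} (hx : x ∈ OH2) :
    ContDiffAt ℝ n (F := ContBilinMap OctPlane ℝ) hypForm x := by
  rw [← affineForm_neg_one]
  refine contDiffAt_conformalQuadratic (E := OctPlane) _ _ _ ?_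
  rw [planeForm_one_one_self]
  linarith [OH2.one_sub_norm_sq_pos hx]

theorem OH2.exists_riemannianMetric :
    ∃ g : Bundle.ContMDiffRiemannianMetric 𝓘(ℝ, OctPlane) ∞ OctPlane
        (fun p : OH2 => TangentSpace 𝓘(ℝ, OctPlane) p), ∀ p, g.inner p = OH2.metric p :=
  ⟨{ inner := OH2.metric
     symm := fun p v w => hypForm_comm p v w
     pos := fun p v hv => hypForm_pos p.2 hv
     isVonNBounded := fun p => by
       refine (NormedSpace.isVonNBounded_ball ℝ OctPlane 1).subset fun v hv => ?_
       have h := (norm_sq_le_hypForm p.2 v).trans_lt hv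
       refine (mem_ball_zero_iff (E := OctPlane)).2 (max_lt_iff.2 ?_)
       constructor <;> nlinarith [norm_nonneg v.1, norm_nonneg v.2]
     contMDiff := contMDiff_opens_bilinForm_section OH2.metric
       (fun _ _ _ => rfl) fun x hx => contDiffAt_hypForm hx }, fun _ => rfl⟩

/-- The curvature tensor of `𝕆P²` at `[1, 0, 0]`. -/
noncomputable def planeCurvature (X Y Z W : OctPlane) : ℝ :=
  4 * inner ℝ X.1 Z.1 * inner ℝ Y.1 W.1 - 4 * inner ℝ Y.1 Z.1 * inner ℝ X.1 W.1
    + 4 * inner ℝ X.2 Z.2 * inner ℝ Y.2 W.2 - 4 * inner ℝ Y.2 Z.2 * inner ℝ X.2 W.2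
    - inner ℝ (Z.1 * star Y.2) (W.1 * star X.2) + inner ℝ (Z.1 * star X.2) (W.1 * star Y.2)
    - inner ℝ (Y.1 * star Z.2) (X.1 * star W.2) + inner ℝ (X.1 * star Z.2) (Y.1 * star W.2)
    - inner ℝ (X.1 * star Y.2 - Y.1 * star X.2) (W.1 * star Z.2 - Z.1 * star W.2)

/-- The second derivative at the origin of `affineForm ε`, divided by `ε`. -/
noncomputable def affineHess (x y z w : OctPlane) : ℝ :=
  planeQuad x y z w + planeQuad y x z w
    - 2 * (planeForm 1 1 0 x y + planeForm 1 1 0 y x) * planeForm 1 1 0 z w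

theorem affineHess_alternation (X Y Z W : OctPlane) :
    1 / 2 * (affineHess Y Z X W - affineHess Y W X Z - affineHess X Z Y W + affineHess X W Y Z)
      = planeCurvature X Y Z W := by
  obtain ⟨a, b⟩ := X
  obtain ⟨c, d⟩ := Y
  obtain ⟨e, f⟩ := Z
  obtain ⟨g, h⟩ := W
  have hcg := Octonion.inner_mul_mul_add_inner_mul_mul c g (star f) (star b)
  have hae := Octonion.inner_mul_mul_add_inner_mul_mul a e (star h) (star d)
  have hce := Octonion.inner_mul_mul_add_inner_mul_mul c e (star h) (star b)
  have hag := Octonion.inner_mul_mul_add_inner_mul_mul a g (star f) (star d)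
  simp only [affineHess, planeQuad_apply, planeForm_apply, planeCurvature, inner_zero_left,
    inner_neg_left, inner_sub_left, inner_sub_right]
  simp only [Octonion.inner_star_star, real_inner_comm] at hcg hae hce hag ⊢
  linear_combination -hcg - hae + hce + hag

theorem riemannCurvature_eq_planeCurvature {M : Type*} [TopologicalSpace M]
    [ChartedSpace OctPlane M]
    {g : ∀ q : M, TangentSpace 𝓘(ℝ, OctPlane) q →L[ℝ] TangentSpace 𝓘(ℝ, OctPlane) q →L[ℝ] ℝ}
    {p : M} {ε : ℝ} (hp : chartAt OctPlane p p = 0)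
    (hg : chartMetric g p =ᶠ[𝓝 (0 : OctPlane)] affineForm ε) (X Y Z W : OctPlane) :
    riemannCurvature g p X Y Z W = ε * planeCurvature X Y Z W := by
  have hgp : (g p : ContBilinMap OctPlane ℝ) = planeForm 1 1 0 := by
    refine (chartMetric_chartAt_self g p).symm.trans ?_
    rw [hp]
    exact hg.self_of_nhds.trans (affineForm_zero ε)
  obtain ⟨H, hH, hH_apply⟩ := exists_hasCriticalHessianAt_conformalQuadratic (E := OctPlane)
    (planeForm 1 1 0 : ContBilinMap OctPlane ℝ) planeQuad (planeForm 1 1 0) ε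
  have hH_eq : ∀ x y z w : OctPlane, H x y z w = ε * affineHess x y z w := fun x y z w => by
    rw [hH_apply]
    rfl
  have hcrit := hH.congr_of_eventuallyEq hg
  rw [← hp] at hcrit
  rw [riemannCurvature_eq_of_chartMetric hcrit (hgp ▸ isInvertible_planeForm_one_one),
    hH_eq, hH_eq, hH_eq, hH_eq, ← affineHess_alternation]
  ring

theorem OH2.riemannCurvature_origin (X Y Z W : OctPlane) :
    riemannCurvature OH2.metric OH2.origin X Y Z W = -planeCurvature X Y Z W := by
  rw [riemannCurvature_eq_planeCurvature (ε := -1) rfl ?_, neg_one_mul]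
  filter_upwards [OH2.isOpen.mem_nhds OH2.origin.2] with x hx
  rw [chartMetric_eq OH2.metric OH2.origin
    (by rwa [chartAt_opens_target]) rfl, affineForm_neg_one]
  exact congrArg hypForm (coe_chartAt_opens_symm OH2.origin hx)

theorem OP2.chartAt_param_zero (x : OctPlane) : chartAt OctPlane (OP2.param 0 x) = OP2.chart 0 := by
  change OP2.chart (OP2.chartIndex (OP2.param 0 x)) = OP2.chart 0
  rw [OP2.chartIndex, if_pos ⟨x, rfl⟩]

theorem OP2.chart_param (i : Fin 3) (x : OctPlane) : OP2.chart i (OP2.param i x) = x :=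
  (OP2.isOpenEmbedding_param i).toOpenPartialHomeomorph_left_inv (OP2.param i)

theorem OP2.metric_param_zero (x : OctPlane) :
    (OP2.metric (OP2.param 0 x) : ContBilinMap OctPlane ℝ) = projForm x := by
  change projForm (chartAt OctPlane (OP2.param 0 x) (OP2.param 0 x)) = _
  rw [OP2.chartAt_param_zero, OP2.chart_param]

theorem OP2.riemannCurvature_basePoint (X Y Z W : OctPlane) :
    riemannCurvature OP2.metric OP2.basePoint X Y Z W = planeCurvature X Y Z W := by
  have hchart : chartAt OctPlane OP2.basePoint = OP2.chart 0 := OP2.chartAt_param_zero _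
  rw [riemannCurvature_eq_planeCurvature (ε := 1) ?_ (.of_forall fun x => ?_), one_mul]
  · rw [hchart]
    exact OP2.chart_param 0 _
  · rw [chartMetric_eq OP2.metric OP2.basePoint (by rw [hchart]; exact Set.mem_univ x)
      (by rw [hchart]; exact OP2.chartAt_param_zero x), affineForm_one, hchart]
    exact OP2.metric_param_zero x

theorem mainTheorem11 :
    -- `𝕆H²` is a smooth 16-dimensional simply connected manifold
    (Module.finrank ℝ OctPlane = 16 ∧ IsManifold 𝓘(ℝ, OctPlane) ∞ OH2 ∧ T2Space OH2 ∧
      SecondCountableTopology OH2 ∧ SimplyConnectedSpace OH2) ∧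
    -- its metric is a smooth Riemannian metric
    (∃ g : Bundle.ContMDiffRiemannianMetric 𝓘(ℝ, OctPlane) ∞ OctPlane
        (fun p : OH2 => TangentSpace 𝓘(ℝ, OctPlane) p), ∀ p, g.inner p = OH2.metric p) ∧
    -- its isometry group acts transitively
    IsHomogeneousMetric OH2.metric ∧
    -- its curvature at the origin is the negative of that of `𝕆P²` at `[1, 0, 0]`
    (∀ X Y Z W : OctPlane,
      riemannCurvature OH2.metric OH2.origin X Y Z W
        = -riemannCurvature OP2.metric OP2.basePoint X Y Z W) ∧
    -- and the latter is given explicitly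
    (∀ a b c d e f g h : Octonion,
      riemannCurvature OP2.metric OP2.basePoint (a, b) (c, d) (e, f) (g, h)
        = 4 * inner ℝ a e * inner ℝ c g - 4 * inner ℝ c e * inner ℝ a g
          + 4 * inner ℝ b f * inner ℝ d h - 4 * inner ℝ d f * inner ℝ b h
          - inner ℝ (e * star d) (g * star b) + inner ℝ (e * star b) (g * star d)
          - inner ℝ (c * star f) (a * star h) + inner ℝ (a * star f) (c * star h)
          - inner ℝ (a * star d - c * star b) (g * star f - e * star h)) := by
  refine ⟨⟨finrank_octPlane, inferInstance, inferInstance, inferInstance,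
    OH2.simplyConnectedSpace⟩, OH2.exists_riemannianMetric, OH2.isHomogeneousMetric,
    fun X Y Z W => ?_, fun a b c d e f g h => ?_⟩
  · rw [OH2.riemannCurvature_origin, OP2.riemannCurvature_basePoint]
  · exact OP2.riemannCurvature_basePoint (a, b) (c, d) (e, f) (g, h)
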